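/- Theorem. Fix $r\in(0,\infty)$ and let $v=(1+r^{-1})^{-1}$. Given $\theta\in\mathbb R^n$, let $X\sim N_n(\theta,I)$ and $Y\sim N_n(\theta,rI)$ be independent. A predictive density estimator is a jointly measurable function $\hat p(y\mid x)\ge 0$ with $\int\hat p(y\mid x)\,dy=1$ for every $x\in\mathbb{R}^n$; its Kullback–Leibler risk is $$\rho(\theta,\hat p)=\int\Big(\int p(y\mid\theta,r)\log\frac{p(y\mid\theta,r)}{\hat p(y\mid x)}\,dy\Big)\,p(x\mid\theta,1)\,dx\in[0,\infty],$$ where $p(\cdot\mid\theta,\sigma^2)$ is the density of $N_n(\theta,\sigma^2 I)$. Let $\Theta_n[s]=\{\theta\in\mathbb R^n:\#\{i:\theta_i\ne0\}\le s\}$ and $R_N(\Theta)=\inf_{\hat p}\sup_{\theta\in\Theta}\rho(\theta,\hat p)$, the infimum being over all predictive density estimators. For $\eta\in(0,1)$ put $\lambda=\sqrt{2\log\eta^{-v}}$, $b=\min\{4r(1+r)/(1+2r),\,1\}$, $K=1+\lceil 2b^{-3/2}\rceil$, $\nu_k=\lambda+(k-1)b\lambda$ for $1\le k\le K$, $\mu_j=\nu_K+j\lambda$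 for $j\ge1$, and $$\nu_B^+=c\Big[\sum_{k=1}^K\eta^{(k-1)vb^2}\delta_{\nu_k}+\eta^{(K-1)vb^2}\sum_{j=1}^\infty\eta^{jv}\delta_{\mu_j}\Big],\qquad \pi_B[\eta]=(1-\eta)\delta_0+\tfrac12\eta(\nu_B^++\nu_B^-),$$ where $c=c(\eta)$ makes $\nu_B^+$ a probability measure and $\nu_B^-$ is the reflection of $\nu_B^+$ about $0$. Let $s_n$ be integers with $s_n\ge1$ for all large $n$ and $\eta_n=s_n/n\to0$ as $n\to\infty$. Let $\pi_{B,n}$ be the law of $n$ i.i.d. draws from $\pi_B[\eta_n]$ and let $\hat p_B(y\mid x)=\int p(y\mid\theta,r)\,\pi_{B,n}(d\theta\mid x)$ be its Bayes predictive density, with $\pi_{B,n}(d\theta\mid x)\propto p(x\mid\theta,1)\,\pi_{B,n}(d\theta)$. Then $$\sup_{\theta\in\Theta_n[s_n]}\rho(\theta,\hat p_B)=R_N(\Theta_n[s_n])\,(1+o(1))\qquad\text{as }n\to\infty,$$ where both sides are positive and finite for all large $n$. -/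

import Mathlib

open MeasureTheory ProbabilityTheory InformationTheory Filter Topology
open scoped ENNReal NNReal

noncomputable section

namespace SparsePrediction

/-! ### The Gaussian prediction model -/

/-- The law `N_n(θ, σ² I)` on `ℝⁿ`. -/
def gaussianLaw {n : ℕ} (σ2 : ℝ≥0) (θ : Fin n → ℝ) : Measure (Fin n → ℝ) :=
  Measure.pi fun i => gaussianReal (θ i) σ2

/-- The Lebesgue density `z ↦ p(z | θ, σ²)` of `N_n(θ, σ² I)`. -/
def gaussianDensity {n : ℕ} (σ2 : ℝ≥0) (θ z : Fin n → ℝ) : ℝ≥0∞ :=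
  ∏ i, gaussianPDF (θ i) σ2 (z i)

/-- `p` is a predictive density estimator: `y ↦ p x y` is a probability density on `ℝⁿ`
for every past observation `x`, jointly measurable in `(x, y)`. -/
structure IsPredictiveDensity {n : ℕ} (p : (Fin n → ℝ) → (Fin n → ℝ) → ℝ≥0∞) : Prop where
  measurable : Measurable (Function.uncurry p)
  lintegral_eq_one : ∀ x, ∫⁻ y, p x y = 1

/-- The Kullback-Leibler loss `L(θ, q) = ∫ p(y | θ, r) log (p(y | θ, r) / q(y)) dy ∈ [0, ∞]`
of the predictive density `q`, when the future observation is `Y ∼ N_n(θ, r I)`. -/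
def klLoss {n : ℕ} (r : ℝ≥0) (θ : Fin n → ℝ) (q : (Fin n → ℝ) → ℝ≥0∞) : ℝ≥0∞ :=
  klDiv (gaussianLaw r θ) (volume.withDensity q)

/-- The Kullback-Leibler risk `ρ(θ, p)`: the loss averaged over the past observation
`X ∼ N_n(θ, I)`. -/
def klRisk {n : ℕ} (r : ℝ≥0) (θ : Fin n → ℝ) (p : (Fin n → ℝ) → (Fin n → ℝ) → ℝ≥0∞) : ℝ≥0∞ :=
  ∫⁻ x, klLoss r θ (p x) ∂(gaussianLaw 1 θ)

/-- The maximal risk `sup_{θ ∈ Θ} ρ(θ, p)`. -/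
def maxRisk {n : ℕ} (r : ℝ≥0) (Θ : Set (Fin n → ℝ))
    (p : (Fin n → ℝ) → (Fin n → ℝ) → ℝ≥0∞) : ℝ≥0∞ :=
  ⨆ θ ∈ Θ, klRisk r θ p

/-- The minimax risk over `Θ`, the infimum being over all predictive density estimators. -/
def minimaxRisk {n : ℕ} (r : ℝ≥0) (Θ : Set (Fin n → ℝ)) : ℝ≥0∞ :=
  ⨅ (p : (Fin n → ℝ) → (Fin n → ℝ) → ℝ≥0∞) (_ : IsPredictiveDensity p), maxRisk r Θ p

/-- The `ℓ₀`-ball: vectors with at most `s` nonzero coordinates. -/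
def sparseBall (n s : ℕ) : Set (Fin n → ℝ) := {θ | hammingNorm θ ≤ s}

/-! ### Bayes predictive densities -/

/-- The posterior `π(dθ | x)` for the prior `π` and the observation `X = x`, `X ∼ N_n(θ, I)`,
by Bayes' formula. -/
def posterior {n : ℕ} (π : Measure (Fin n → ℝ)) (x : Fin n → ℝ) : Measure (Fin n → ℝ) :=
  (∫⁻ θ, gaussianDensity 1 θ x ∂π)⁻¹ • π.withDensity fun θ => gaussianDensity 1 θ x

/-- The Bayes predictive density `p̂_π(y | x) = ∫ p(y | θ, r) π(dθ | x)`. -/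
def bayesDensity {n : ℕ} (r : ℝ≥0) (π : Measure (Fin n → ℝ)) (x y : Fin n → ℝ) : ℝ≥0∞ :=
  ∫⁻ θ, gaussianDensity r θ y ∂(posterior π x)

/-! ### The bi-grid prior -/

/-- The oracle variance `v = (1 + r⁻¹)⁻¹`. -/
def oracleVar (r : ℝ) : ℝ := (1 + r⁻¹)⁻¹

/-- The outer spacing `λ = √(2 log η^{-v})`. -/
def spacing (r η : ℝ) : ℝ := √(2 * Real.log (η ^ (-oracleVar r)))

/-- The inner spacing factor `b = min {4r(1+r)/(1+2r), 1}`. -/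
def innerFactor (r : ℝ) : ℝ := min (4 * r * (1 + r) / (1 + 2 * r)) 1

/-- The number `K = 1 + ⌈2 b^{-3/2}⌉` of support points in the inner zone. -/
def innerCard (r : ℝ) : ℕ := 1 + ⌈2 * innerFactor r ^ (-(3 / 2) : ℝ)⌉₊

/-- The inner support points `ν_k = λ + (k - 1) b λ`, `k = 1, …, K`. -/
def innerPoint (r η : ℝ) (k : ℕ) : ℝ :=
  spacing r η + ((k : ℝ) - 1) * innerFactor r * spacing r η

/-- The outer support points `μ_j = ν_K + j λ`, `j = 1, 2, …`. -/
def outerPoint (r η : ℝ) (j : ℕ) : ℝ :=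
  innerPoint r η (innerCard r) + (j : ℝ) * spacing r η

/-- The constant `c` that makes the one-sided bi-grid measure a probability measure. -/
def normConst (r η : ℝ) : ℝ :=
  let v := oracleVar r
  let b := innerFactor r
  let K : ℝ := innerCard r
  ((1 - η ^ (b ^ 2 * v * K)) / (1 - η ^ (b ^ 2 * v))
    + η ^ (b ^ 2 * v * (K - 1) + v) / (1 - η ^ v))⁻¹

/-- The one-sided bi-grid measure on `(0, ∞)`:
`c [∑_{k=1}^K η^{(k-1)vb²} δ_{ν_k} + η^{(K-1)vb²} ∑_{j≥1} η^{jv} δ_{μ_j}]`. -/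
def biGridPos (r η : ℝ) : Measure ℝ :=
  let v := oracleVar r
  let b := innerFactor r
  let K := innerCard r
  ENNReal.ofReal (normConst r η) •
    ((∑ k ∈ Finset.Icc 1 K,
        ENNReal.ofReal (η ^ (((k : ℝ) - 1) * v * b ^ 2)) • Measure.dirac (innerPoint r η k))
      + ENNReal.ofReal (η ^ (((K : ℝ) - 1) * v * b ^ 2)) •
        Measure.sum fun j : ℕ =>
          ENNReal.ofReal (η ^ (((j + 1 : ℕ) : ℝ) * v)) • Measure.dirac (outerPoint r η (j + 1)))

/-- The sparse symmetric prior `(1 - η) δ₀ + (η / 2) (ν⁺ + ν⁻)`, where `ν⁻` is the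
reflection of `ν⁺`. -/
def sparsePrior (η : ℝ) (νpos : Measure ℝ) : Measure ℝ :=
  ENNReal.ofReal (1 - η) • Measure.dirac 0
    + ENNReal.ofReal (η / 2) • (νpos + νpos.map fun t => -t)

/-- The univariate bi-grid prior `π_B[η]`. -/
def biGridPrior (r η : ℝ) : Measure ℝ := sparsePrior η (biGridPos r η)

/-- The multivariate bi-grid prior: `n` i.i.d. draws from `π_B[η]`. -/
def biGridPriorPi (n : ℕ) (r η : ℝ) : Measure (Fin n → ℝ) :=
  Measure.pi fun _ => biGridPrior r η

end SparsePrediction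

end

/-! Write κ = 1/r and let λ be the spacing, so that η = exp(-(1+κ)λ²/2) and λ → ∞. The minimax risk
is at least s(κλ²/2 - O(λ)), and the maximal risk of the bi-grid Bayes density is at most s(κλ²/2 +
O(λ)), with constants depending only on r. Since that density is itself an estimator, the quotient
lies between 1 and a ratio tending to 1.

Upper bound (`maxRisk_bayesDensity_biGrid_le`). At every y, a Bayes predictive density dominates p(y
| θ', r) times the posterior mass of any atom θ' of the prior. Its loss at θ is therefore at most
|θ-θ'|²/(2r) minus the logarithm of that mass, and for a product prior this splits over coordinates
(`klRisk_bayesDensity_pi_le`). A zero coordinate is matched with the atom 0 and costs at most 2η,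
which adds up to 2s. A coordinate t = λτ may be matched with any atom λσ. The atoms have mass
exp(-λ²q(σ)/2) up to constants, so the cost is, up to O(λ), λ²/2 times q(σ) + (1+κ)(σ-τ)² - min over
σ' of [q(σ') + (σ'-τ)²]. The bi-grid is built so that for every τ some atom keeps this at most κ
(`exists_scaledPoint`). The penalty q grows by the square of each gap, which settles the comparison
among grid points. Beating the origin is the delicate part: it dictates the inner spacing b and the
length of the inner zone (`exists_le_origin`).

Lower bound (`ofReal_le_minimaxRisk`). Cut the coordinates into s blocks of m = ⌊n/s⌋ and put one
spike of height h in each, where (1+κ)h²/2 = log m. The linearised Donsker-Varadhan inequality is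
applied with a test function that minorises the logarithm of m^s times the posterior probability of
the spike positions given (x, y), minus the log-likelihood ratio of x. Posterior probabilities sum
to one, so the exponential moment of the test function, averaged over the positions, is at most 1
for every estimator. Its mean is at least log m - h²/2 - O(h) = κh²/2 - O(h) per block, with the
O(h) taken for large h. -/

noncomputable section

namespace SparsePrediction

/-! ### Integrals over finite products -/

theorem lintegral_pi_prod {n : ℕ} {μ : Fin n → Measure ℝ} [∀ i, SigmaFinite (μ i)]
    {f : Fin n → ℝ → ℝ≥0∞} (hf : ∀ i, Measurable (f i)) :
    ∫⁻ x, ∏ i, f i (x i) ∂(Measure.pi μ) = ∏ i, ∫⁻ t, f i t ∂(μ i) := by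
  induction n with
  | zero => simp
  | succ n ih =>
    rw [← ((measurePreserving_piFinSuccAbove μ 0).symm _).lintegral_comp_emb
      (MeasurableEquiv.measurableEmbedding _)]
    simp_rw [Fin.prod_univ_succ, MeasurableEquiv.piFinSuccAbove_symm_apply, Fin.insertNthEquiv,
      Fin.zero_succAbove, Equiv.coe_fn_mk, Fin.insertNth_zero', Fin.cons_zero, Fin.cons_succ]
    have h2 : Measurable fun x : Fin n → ℝ => ∏ i, f i.succ (x i) :=
      Finset.measurable_prod _ fun i _ => (hf _).comp (measurable_pi_apply i)
    rw [lintegral_prod_mul (f := f 0) (g := fun x : Fin n → ℝ => ∏ i, f i.succ (x i))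
      (hf 0).aemeasurable h2.aemeasurable, ih fun i => hf _]

theorem measurable_gaussianDensity_comp {α : Type*} [MeasurableSpace α] {n : ℕ} (σ2 : ℝ≥0)
    {f g : α → Fin n → ℝ} (hf : Measurable f) (hg : Measurable g) :
    Measurable fun a => gaussianDensity σ2 (f a) (g a) := by
  unfold gaussianDensity
  refine Finset.measurable_prod _ fun i _ => ?_
  have h : Measurable fun a => (f a i, σ2, g a i) := by fun_prop
  exact measurable_uncurry_gaussianPDF.comp h

theorem measurable_gaussianDensity_left {n : ℕ} (σ2 : ℝ≥0) (z : Fin n → ℝ) :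
    Measurable fun θ => gaussianDensity σ2 θ z :=
  measurable_gaussianDensity_comp σ2 measurable_id measurable_const

theorem measurable_gaussianDensity_right {n : ℕ} (σ2 : ℝ≥0) (θ : Fin n → ℝ) :
    Measurable (gaussianDensity σ2 θ) :=
  measurable_gaussianDensity_comp σ2 measurable_const measurable_id

theorem measurable_gaussianPDF_comp {α : Type*} [MeasurableSpace α] (σ2 : ℝ≥0)
    {f g : α → ℝ} (hf : Measurable f) (hg : Measurable g) :
    Measurable fun a => gaussianPDF (f a) σ2 (g a) := by
  have h : Measurable fun a => (f a, σ2, g a) := by fun_prop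
  exact measurable_uncurry_gaussianPDF.comp h

instance {n : ℕ} (σ2 : ℝ≥0) (θ : Fin n → ℝ) : IsProbabilityMeasure (gaussianLaw σ2 θ) := by
  unfold gaussianLaw; infer_instance

theorem gaussianLaw_eq_withDensity {n : ℕ} {σ2 : ℝ≥0} (hσ : σ2 ≠ 0) (θ : Fin n → ℝ) :
    gaussianLaw σ2 θ = volume.withDensity (gaussianDensity σ2 θ) := by
  refine Measure.pi_eq fun s hs => ?_
  rw [withDensity_apply _ (MeasurableSet.univ_pi hs),
    ← lintegral_indicator (MeasurableSet.univ_pi hs)]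
  have h : ∀ x : Fin n → ℝ, (Set.univ.pi s).indicator (gaussianDensity σ2 θ) x
      = ∏ i, (s i).indicator (gaussianPDF (θ i) σ2) (x i) := by
    intro x
    by_cases hx : x ∈ Set.univ.pi s
    · rw [Set.indicator_of_mem hx]
      exact Finset.prod_congr rfl fun i _ => (Set.indicator_of_mem (hx i (Set.mem_univ _)) _).symm
    · rw [Set.indicator_of_notMem hx]
      simp only [Set.mem_pi, Set.mem_univ, forall_const, not_forall] at hx
      obtain ⟨i, hi⟩ := hx
      exact (Finset.prod_eq_zero (Finset.mem_univ i) (Set.indicator_of_notMem hi _)).symm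
  simp_rw [h]
  rw [volume_pi, lintegral_pi_prod fun i => (measurable_gaussianPDF _ _).indicator (hs i)]
  refine Finset.prod_congr rfl fun i _ => ?_
  rw [lintegral_indicator (hs i), gaussianReal_apply _ hσ]

theorem gaussianDensity_pos {n : ℕ} {σ2 : ℝ≥0} (hσ : σ2 ≠ 0) (θ z : Fin n → ℝ) :
    0 < gaussianDensity σ2 θ z :=
  pos_iff_ne_zero.2 (Finset.prod_ne_zero_iff.2 fun _ _ => (gaussianPDF_pos _ hσ _).ne')

theorem gaussianDensity_lt_top {n : ℕ} (σ2 : ℝ≥0) (θ z : Fin n → ℝ) :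
    gaussianDensity σ2 θ z < ∞ :=
  ENNReal.prod_lt_top fun _ _ => gaussianPDF_lt_top

theorem lintegral_gaussianDensity {n : ℕ} {σ2 : ℝ≥0} (hσ : σ2 ≠ 0) (θ : Fin n → ℝ) :
    ∫⁻ z, gaussianDensity σ2 θ z = 1 := by
  have := congrArg (fun μ => μ Set.univ) (gaussianLaw_eq_withDensity hσ θ)
  simpa using this.symm

/-! ### Bounds on the Kullback-Leibler divergence -/

/-- An upper bound on the log-likelihood ratio bounds the divergence by its mean. -/
theorem klDiv_le_ofReal_integral {α : Type*} [MeasurableSpace α] {μ ν : Measure α}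
    [IsProbabilityMeasure μ] [IsProbabilityMeasure ν] (hμν : μ ≪ ν) {U : α → ℝ}
    (hU : Integrable U μ) (h : ∀ᵐ x ∂ν, Real.log (μ.rnDeriv ν x).toReal ≤ U x) :
    klDiv μ ν ≤ ENNReal.ofReal (∫ x, U x ∂μ) := by
  rw [klDiv_eq_lintegral_klFun_of_ac hμν]
  have h1 : Integrable (fun x => (μ.rnDeriv ν x).toReal * U x) ν := by
    simpa using (integrable_rnDeriv_smul_iff hμν).2 hU
  have h2 : Integrable (fun x => (μ.rnDeriv ν x).toReal) ν := Measure.integrable_toReal_rnDeriv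
  have h12 : Integrable (fun x => (μ.rnDeriv ν x).toReal * U x + 1) ν :=
    h1.add (integrable_const _)
  have h5 : Integrable
      (fun x => (μ.rnDeriv ν x).toReal * U x + 1 - (μ.rnDeriv ν x).toReal) ν := h12.sub h2
  have h3 : ∫ x, (μ.rnDeriv ν x).toReal * U x ∂ν = ∫ x, U x ∂μ := by
    simpa using integral_rnDeriv_smul hμν (f := U)
  have h4 : ∫ x, (μ.rnDeriv ν x).toReal ∂ν = 1 := by
    simp [Measure.integral_toReal_rnDeriv hμν]
  have hle : ∀ᵐ x ∂ν, klFun (μ.rnDeriv ν x).toReal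
      ≤ (μ.rnDeriv ν x).toReal * U x + 1 - (μ.rnDeriv ν x).toReal := by
    filter_upwards [h] with x hx
    rw [klFun_apply]
    have := mul_le_mul_of_nonneg_left hx (ENNReal.toReal_nonneg (a := μ.rnDeriv ν x))
    linarith
  calc _ ≤ ∫⁻ x, ENNReal.ofReal
        ((μ.rnDeriv ν x).toReal * U x + 1 - (μ.rnDeriv ν x).toReal) ∂ν :=
        lintegral_mono_ae (hle.mono fun x hx => ENNReal.ofReal_le_ofReal hx)
    _ = ENNReal.ofReal (∫ x, ((μ.rnDeriv ν x).toReal * U x + 1 - (μ.rnDeriv ν x).toReal) ∂ν) := by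
        rw [ofReal_integral_eq_lintegral_ofReal h5]
        filter_upwards [hle] with x hx
        exact (klFun_nonneg ENNReal.toReal_nonneg).trans hx
    _ = _ := by
        rw [integral_sub h12 h2, integral_add h1 (integrable_const _),
          h3, h4]
        simp

/-- The variational (Donsker-Varadhan) lower bound on the divergence, in linearised form. -/
theorem ofReal_integral_le_klDiv_add {α : Type*} [MeasurableSpace α] {μ ν : Measure α}
    [IsProbabilityMeasure μ] [IsProbabilityMeasure ν] {g : α → ℝ} (hgm : Measurable g)
    (hg : Integrable g μ) :
    ENNReal.ofReal (1 + ∫ x, g x ∂μ)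
      ≤ klDiv μ ν + ∫⁻ x, ENNReal.ofReal (Real.exp (g x)) ∂ν := by
  by_cases htop : klDiv μ ν = ∞
  · simp [htop]
  by_cases hexp : ∫⁻ x, ENNReal.ofReal (Real.exp (g x)) ∂ν = ∞
  · simp [hexp]
  have hac := (klDiv_ne_top_iff.1 htop).1
  have hei : Integrable (fun x => Real.exp (g x)) ν :=
    (lintegral_ofReal_ne_top_iff_integrable hgm.exp.aestronglyMeasurable
      (ae_of_all _ fun x => (Real.exp_pos _).le)).1 hexp
  have h1 : Integrable (fun x => (μ.rnDeriv ν x).toReal * g x) ν := by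
    simpa using (integrable_rnDeriv_smul_iff hac).2 hg
  have h3 : ∫ x, (μ.rnDeriv ν x).toReal * g x ∂ν = ∫ x, g x ∂μ := by
    simpa using integral_rnDeriv_smul hac (f := g)
  have hk : Integrable (fun x => klFun (μ.rnDeriv ν x).toReal) ν :=
    (integrable_klFun_rnDeriv_iff hac).2 (klDiv_ne_top_iff.1 htop).2
  rw [klDiv_eq_lintegral_klFun_of_ac hac, ← ofReal_integral_eq_lintegral_ofReal hk
    (ae_of_all _ fun x => klFun_nonneg ENNReal.toReal_nonneg),
    ← ofReal_integral_eq_lintegral_ofReal hei (ae_of_all _ fun x => (Real.exp_pos _).le),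
    ← ENNReal.ofReal_add (integral_nonneg fun x => klFun_nonneg ENNReal.toReal_nonneg)
      (integral_nonneg fun x => (Real.exp_pos _).le)]
  refine ENNReal.ofReal_le_ofReal ?_
  rw [← integral_add hk hei, ← h3]
  have : (1 : ℝ) + ∫ x, (μ.rnDeriv ν x).toReal * g x ∂ν
      = ∫ x, (1 + (μ.rnDeriv ν x).toReal * g x) ∂ν := by
    rw [integral_add (integrable_const _) h1]; simp
  rw [this]
  refine integral_mono ((integrable_const _).add h1) (hk.add hei) fun x => ?_
  simp only [klFun_apply]
  set f := (μ.rnDeriv ν x).toReal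
  rcases (ENNReal.toReal_nonneg (a := μ.rnDeriv ν x)).eq_or_lt with hf | hf
  · have : f = 0 := hf.symm
    simp [this, (Real.exp_pos (g x)).le]
  · change 0 < f at hf
    -- Young's inequality f g ≤ f log f - f + e^g, from e^z ≥ 1 + z at z = g - log f.
    have e1 : Real.exp (g x) = f * Real.exp (g x - Real.log f) := by
      rw [Real.exp_sub, Real.exp_log hf]; field_simp
    have e2 := mul_le_mul_of_nonneg_left (Real.add_one_le_exp (g x - Real.log f)) hf.le
    rw [e1]; nlinarith

theorem ofReal_integral_le_lintegral_ofReal {α : Type*} [MeasurableSpace α] {μ : Measure α}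
    {f : α → ℝ} (hf : Integrable f μ) :
    ENNReal.ofReal (∫ x, f x ∂μ) ≤ ∫⁻ x, ENNReal.ofReal (f x) ∂μ := by
  have h := integral_mono hf hf.pos_part fun x => le_max_left (f x) 0
  refine (ENNReal.ofReal_le_ofReal h).trans ?_
  rw [ofReal_integral_eq_lintegral_ofReal hf.pos_part (ae_of_all _ fun x => le_max_right _ _)]
  exact lintegral_mono fun x => by simp [ENNReal.ofReal_max]

/-! ### Bayes predictive densities are predictive densities -/

theorem lintegral_mul_singleton_le {α : Type*} [MeasurableSpace α] [MeasurableSingletonClass α]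
    (π : Measure α) (f : α → ℝ≥0∞) (a : α) : π {a} * f a ≤ ∫⁻ x, f x ∂π := by
  calc π {a} * f a = ∫⁻ x in {a}, f x ∂π := by rw [lintegral_singleton, mul_comm]
    _ ≤ _ := setLIntegral_le_lintegral _ _

theorem gaussianPDF_one_le (t u : ℝ) : gaussianPDF t 1 u ≤ 1 := by
  rw [gaussianPDF_def, ENNReal.ofReal_le_one, gaussianPDFReal_def]
  have h1 : (√(2 * Real.pi * (1 : ℝ≥0)))⁻¹ ≤ 1 := by
    refine inv_le_one_of_one_le₀ ?_
    rw [Real.one_le_sqrt]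
    have := Real.pi_gt_three
    simp only [NNReal.coe_one]; linarith
  have h2 : Real.exp (-(u - t) ^ 2 / (2 * (1 : ℝ≥0))) ≤ 1 := by
    rw [Real.exp_le_one_iff]
    have := sq_nonneg (u - t)
    simp only [NNReal.coe_one]; linarith
  exact mul_le_one₀ h1 (Real.exp_pos _).le h2

theorem gaussianDensity_one_le {n : ℕ} (θ x : Fin n → ℝ) : gaussianDensity 1 θ x ≤ 1 :=
  Finset.prod_le_one' fun _ _ => gaussianPDF_one_le _ _

theorem bayesDensity_eq {n : ℕ} (π : Measure (Fin n → ℝ)) (r : ℝ≥0) (x y : Fin n → ℝ) :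
    bayesDensity r π x y = (∫⁻ θ, gaussianDensity 1 θ x ∂π)⁻¹
      * ∫⁻ θ, gaussianDensity 1 θ x * gaussianDensity r θ y ∂π := by
  rw [bayesDensity, posterior, lintegral_smul_measure,
    lintegral_withDensity_eq_lintegral_mul _ (measurable_gaussianDensity_left 1 x)
      (measurable_gaussianDensity_left r y)]
  rfl

theorem IsPredictiveDensity.measurable_apply {n : ℕ} {p : (Fin n → ℝ) → (Fin n → ℝ) → ℝ≥0∞}
    (hp : IsPredictiveDensity p) (x : Fin n → ℝ) : Measurable (p x) :=
  hp.measurable.of_uncurry_left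

section Marginal

variable {n : ℕ} (π : Measure (Fin n → ℝ)) [IsProbabilityMeasure π]

theorem marginal_ne_top (x : Fin n → ℝ) : ∫⁻ θ, gaussianDensity 1 θ x ∂π ≠ ∞ := by
  refine ne_top_of_le_ne_top ENNReal.one_ne_top
    ((lintegral_mono fun θ => gaussianDensity_one_le θ x).trans ?_)
  simp

theorem marginal_ne_zero (x : Fin n → ℝ) : ∫⁻ θ, gaussianDensity 1 θ x ∂π ≠ 0 := by
  rw [← pos_iff_ne_zero, lintegral_pos_iff_support (measurable_gaussianDensity_left 1 x)]
  have : Function.support (fun θ => gaussianDensity 1 θ x) = Set.univ :=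
    Set.eq_univ_of_forall fun θ => (gaussianDensity_pos one_ne_zero θ x).ne'
  simp [this]

theorem isPredictiveDensity_bayesDensity {r : ℝ≥0} (hr : r ≠ 0) :
    IsPredictiveDensity (bayesDensity r π) where
  measurable := by
    have h1 : Measurable fun p : (Fin n → ℝ) × (Fin n → ℝ) =>
        ∫⁻ θ, gaussianDensity 1 θ p.1 ∂π :=
      Measurable.lintegral_prod_right' (f := fun q : ((Fin n → ℝ) × (Fin n → ℝ)) ×
        (Fin n → ℝ) => gaussianDensity 1 q.2 q.1.1)
        (measurable_gaussianDensity_comp 1 (by fun_prop) (by fun_prop))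
    have h2 : Measurable fun p : (Fin n → ℝ) × (Fin n → ℝ) =>
        ∫⁻ θ, gaussianDensity 1 θ p.1 * gaussianDensity r θ p.2 ∂π :=
      Measurable.lintegral_prod_right' (f := fun q : ((Fin n → ℝ) × (Fin n → ℝ)) ×
        (Fin n → ℝ) => gaussianDensity 1 q.2 q.1.1 * gaussianDensity r q.2 q.1.2)
        ((measurable_gaussianDensity_comp 1 (by fun_prop) (by fun_prop)).mul
          (measurable_gaussianDensity_comp r (by fun_prop) (by fun_prop)))
    have : Function.uncurry (bayesDensity r π) = fun p =>
        (∫⁻ θ, gaussianDensity 1 θ p.1 ∂π)⁻¹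
          * ∫⁻ θ, gaussianDensity 1 θ p.1 * gaussianDensity r θ p.2 ∂π := by
      ext ⟨x, y⟩; exact bayesDensity_eq π r x y
    rw [this]
    exact h1.inv.mul h2
  lintegral_eq_one x := by
    have hm : Measurable fun q : (Fin n → ℝ) × (Fin n → ℝ) =>
        gaussianDensity 1 q.2 x * gaussianDensity r q.2 q.1 :=
      (measurable_gaussianDensity_comp 1 (by fun_prop) (by fun_prop)).mul
        (measurable_gaussianDensity_comp r (by fun_prop) (by fun_prop))
    simp_rw [bayesDensity_eq]
    rw [lintegral_const_mul _ hm.lintegral_prod_right', lintegral_lintegral_swap hm.aemeasurable]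
    simp_rw [lintegral_const_mul _ (measurable_gaussianDensity_right r _),
      lintegral_gaussianDensity hr, mul_one]
    exact ENNReal.inv_mul_cancel (marginal_ne_zero π x) (marginal_ne_top π x)

end Marginal

/-! ### Upper bounds for the loss and the risk of a Bayes predictive density -/

theorem gaussianPDF_eq_exp_mul {σ2 : ℝ≥0} (t t' z : ℝ) :
    gaussianPDF t σ2 z
      = ENNReal.ofReal (Real.exp (((z - t') ^ 2 - (z - t) ^ 2) / (2 * σ2)))
        * gaussianPDF t' σ2 z := by
  simp only [gaussianPDF, gaussianPDFReal]
  rw [← ENNReal.ofReal_mul (Real.exp_pos _).le, mul_left_comm, ← Real.exp_add]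
  congr 3
  ring

theorem gaussianDensity_eq_exp_mul {n : ℕ} {σ2 : ℝ≥0} (θ θ' z : Fin n → ℝ) :
    gaussianDensity σ2 θ z
      = ENNReal.ofReal (Real.exp (∑ i, ((z i - θ' i) ^ 2 - (z i - θ i) ^ 2) / (2 * σ2)))
        * gaussianDensity σ2 θ' z := by
  rw [Real.exp_sum, ENNReal.ofReal_prod_of_nonneg fun _ _ => (Real.exp_pos _).le,
    gaussianDensity, gaussianDensity, ← Finset.prod_mul_distrib]
  exact Finset.prod_congr rfl fun i _ => gaussianPDF_eq_exp_mul _ _ _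

theorem integrable_id_gaussianReal (t : ℝ) (σ2 : ℝ≥0) :
    Integrable (fun u => u) (gaussianReal t σ2) :=
  (memLp_id_gaussianReal 1).integrable (by simp)

theorem integrable_sq_sub_sq (t t' : ℝ) (σ2 : ℝ≥0) :
    Integrable (fun u => ((u - t') ^ 2 - (u - t) ^ 2) / (2 * (σ2 : ℝ))) (gaussianReal t σ2) := by
  have : (fun u : ℝ => ((u - t') ^ 2 - (u - t) ^ 2) / (2 * (σ2 : ℝ)))
      = fun u => ((t - t') / σ2) * u + (t' ^ 2 - t ^ 2) / (2 * σ2) := by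
    ext u; field_simp; ring
  rw [this]
  exact ((integrable_id_gaussianReal t σ2).const_mul _).add (integrable_const _)

theorem integral_sq_sub_sq (t t' : ℝ) (σ2 : ℝ≥0) :
    ∫ u, ((u - t') ^ 2 - (u - t) ^ 2) / (2 * (σ2 : ℝ)) ∂(gaussianReal t σ2)
      = (t - t') ^ 2 / (2 * σ2) := by
  have : (fun u : ℝ => ((u - t') ^ 2 - (u - t) ^ 2) / (2 * (σ2 : ℝ)))
      = fun u => ((t - t') / σ2) * u + (t' ^ 2 - t ^ 2) / (2 * σ2) := by
    ext u; field_simp; ring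
  rw [this, integral_add ((integrable_id_gaussianReal t σ2).const_mul _) (integrable_const _),
    integral_const_mul, integral_id_gaussianReal]
  simp only [integral_const, probReal_univ, smul_eq_mul]
  field_simp; ring

/-- The hypothesis bounds the log-likelihood ratio by -log W plus the log ratio of the Gaussian
densities at θ and θ'. The mean of the latter under θ is the Gaussian divergence |θ-θ'|²/(2r). -/
theorem klLoss_le_of_mul_le {n : ℕ} {r : ℝ≥0} (hr : r ≠ 0) (θ θ' : Fin n → ℝ)
    {q : (Fin n → ℝ) → ℝ≥0∞} (hqm : Measurable q) (hq : ∫⁻ y, q y = 1) {W : ℝ} (hW : 0 < W)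
    (h : ∀ y, ENNReal.ofReal W * gaussianDensity r θ' y ≤ q y) :
    klLoss r θ q ≤ ENNReal.ofReal (-Real.log W + ∑ i, (θ i - θ' i) ^ 2 / (2 * (r : ℝ))) := by
  have hq0 : ∀ y, q y ≠ 0 := fun y h0 => by
    have := h y
    rw [h0, nonpos_iff_eq_zero, mul_eq_zero, ENNReal.ofReal_eq_zero] at this
    rcases this with h1 | h1
    · linarith
    · exact (gaussianDensity_pos hr θ' y).ne' h1
  have hqt : ∀ᵐ y, q y < ∞ := ae_lt_top hqm (by simp [hq])
  have hνp : IsProbabilityMeasure (volume.withDensity q) := ⟨by simp [hq]⟩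
  have hpm := measurable_gaussianDensity_right r θ
  -- Since q vanishes nowhere and is finite almost everywhere, the ratio of densities is the
  -- Radon-Nikodym derivative.
  have hdiv : gaussianLaw r θ
      = (volume.withDensity q).withDensity fun y => gaussianDensity r θ y / q y := by
    rw [gaussianLaw_eq_withDensity hr]
    refine Eq.trans ?_ (withDensity_mul _ hqm (hpm.div hqm))
    refine withDensity_congr_ae ?_
    filter_upwards [hqt] with y hy
    exact (ENNReal.mul_div_cancel (hq0 y) hy.ne).symm
  have hac : gaussianLaw r θ ≪ volume.withDensity q := by
    rw [hdiv]; exact withDensity_absolutelyContinuous _ _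
  have hrn : (gaussianLaw r θ).rnDeriv (volume.withDensity q)
      =ᵐ[volume.withDensity q] fun y => gaussianDensity r θ y / q y := by
    conv_lhs => rw [hdiv]
    exact Measure.rnDeriv_withDensity _ (hpm.div hqm)
  have hUi : ∀ i, Integrable (fun y : Fin n → ℝ =>
      ((y i - θ' i) ^ 2 - (y i - θ i) ^ 2) / (2 * (r : ℝ))) (gaussianLaw r θ) := fun i =>
    integrable_comp_eval (μ := fun i => gaussianReal (θ i) r) (integrable_sq_sub_sq (θ i) (θ' i) r)
  have hU : Integrable (fun y : Fin n → ℝ => -Real.log W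
      + ∑ i, ((y i - θ' i) ^ 2 - (y i - θ i) ^ 2) / (2 * (r : ℝ))) (gaussianLaw r θ) :=
    (integrable_const _).add (integrable_finsetSum _ fun i _ => hUi i)
  have hmean : ∫ y, (-Real.log W
      + ∑ i, ((y i - θ' i) ^ 2 - (y i - θ i) ^ 2) / (2 * (r : ℝ))) ∂(gaussianLaw r θ)
      = -Real.log W + ∑ i, (θ i - θ' i) ^ 2 / (2 * (r : ℝ)) := by
    rw [integral_add (integrable_const _) (integrable_finsetSum _ fun i _ => hUi i),
      integral_finsetSum _ fun i _ => hUi i]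
    congr 1
    · simp
    · refine Finset.sum_congr rfl fun i _ => ?_
      rw [← integral_sq_sub_sq]
      exact integral_comp_eval (μ := fun i => gaussianReal (θ i) r)
        (integrable_sq_sub_sq (θ i) (θ' i) r).aestronglyMeasurable
  rw [klLoss, ← hmean]
  refine klDiv_le_ofReal_integral hac hU ?_
  filter_upwards [hrn, withDensity_absolutelyContinuous _ _ hqt] with y hy hyt
  rw [hy]
  set u := ∑ i, ((y i - θ' i) ^ 2 - (y i - θ i) ^ 2) / (2 * (r : ℝ))
  have hpos : 0 < (gaussianDensity r θ y / q y).toReal :=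
    ENNReal.toReal_pos (ENNReal.div_ne_zero.2 ⟨(gaussianDensity_pos hr θ y).ne', hyt.ne⟩)
      (ENNReal.div_ne_top (gaussianDensity_lt_top r θ y).ne (hq0 y))
  rw [Real.log_le_iff_le_exp hpos]
  refine ENNReal.toReal_le_of_le_ofReal (Real.exp_pos _).le ?_
  refine ENNReal.div_le_of_le_mul ?_
  calc gaussianDensity r θ y = ENNReal.ofReal (Real.exp u) * gaussianDensity r θ' y :=
        gaussianDensity_eq_exp_mul _ _ _
    _ = ENNReal.ofReal (Real.exp (-Real.log W + u))
        * (ENNReal.ofReal W * gaussianDensity r θ' y) := by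
        rw [← mul_assoc, ← ENNReal.ofReal_mul (Real.exp_pos _).le, Real.exp_add, Real.exp_neg,
          Real.exp_log hW]
        congr 2; field_simp
    _ ≤ _ := by gcongr; exact h y

/-- The posterior mass of the point `t` in the univariate problem with prior `π` and
observation `u`. -/
def atomWeight (π : Measure ℝ) (t u : ℝ) : ℝ≥0∞ :=
  (∫⁻ s, gaussianPDF s 1 u ∂π)⁻¹ * (π {t} * gaussianPDF t 1 u)

theorem atomWeight_le_one (π : Measure ℝ) (t u : ℝ) : atomWeight π t u ≤ 1 := by
  rw [atomWeight, mul_comm, ← div_eq_mul_inv]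
  exact ENNReal.div_le_of_le_mul
    (by rw [one_mul]; exact lintegral_mul_singleton_le π (fun s => gaussianPDF s 1 u) t)

theorem atomWeight_ne_top (π : Measure ℝ) (t u : ℝ) : atomWeight π t u ≠ ∞ :=
  ne_top_of_le_ne_top ENNReal.one_ne_top (atomWeight_le_one π t u)

theorem log_atomWeight_nonpos (π : Measure ℝ) (t u : ℝ) : Real.log (atomWeight π t u).toReal ≤ 0 :=
  Real.log_nonpos ENNReal.toReal_nonneg
    (ENNReal.toReal_le_of_le_ofReal zero_le_one (by simpa using atomWeight_le_one π t u))

/-- Approximating the coordinate `t` by the atom `t'` of the prior `π`, the coordinate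
contributes at most this quantity to the risk of the Bayes predictive density. -/
def coordRisk (r : ℝ≥0) (π : Measure ℝ) (t t' : ℝ) : ℝ≥0∞ :=
  ENNReal.ofReal ((t - t') ^ 2 / (2 * (r : ℝ)))
    + ∫⁻ u, ENNReal.ofReal (-Real.log (atomWeight π t' u).toReal) ∂(gaussianReal t 1)

/-! ### One coordinate: the cost of keeping a single atom of the posterior. -/

section Univariate

variable (π : Measure ℝ) [IsProbabilityMeasure π]

theorem measurable_gaussianPDF_left (σ2 : ℝ≥0) (u : ℝ) :
    Measurable fun s => gaussianPDF s σ2 u :=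
  measurable_gaussianPDF_comp σ2 measurable_id measurable_const

theorem marginal_one_ne_top (u : ℝ) : ∫⁻ s, gaussianPDF s 1 u ∂π ≠ ∞ := by
  refine ne_top_of_le_ne_top ENNReal.one_ne_top
    ((lintegral_mono fun s => gaussianPDF_one_le s u).trans ?_)
  simp

theorem marginal_one_ne_zero (u : ℝ) : ∫⁻ s, gaussianPDF s 1 u ∂π ≠ 0 := by
  rw [← pos_iff_ne_zero, lintegral_pos_iff_support (measurable_gaussianPDF_left 1 u)]
  have : Function.support (fun s => gaussianPDF s 1 u) = Set.univ :=
    Set.eq_univ_of_forall fun s => (gaussianPDF_pos s one_ne_zero u).ne'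
  simp [this]

theorem measurable_marginal_one : Measurable fun u => ∫⁻ s, gaussianPDF s 1 u ∂π :=
  Measurable.lintegral_prod_right' (f := fun q : ℝ × ℝ => gaussianPDF q.2 1 q.1)
    (measurable_gaussianPDF_comp 1 measurable_snd measurable_fst)

theorem measurable_atomWeight (t : ℝ) : Measurable (atomWeight π t) :=
  (measurable_marginal_one π).inv.mul ((measurable_gaussianPDF t 1).const_mul _)

theorem atomWeight_ne_zero {t : ℝ} (ht : π {t} ≠ 0) (u : ℝ) : atomWeight π t u ≠ 0 :=
  mul_ne_zero (ENNReal.inv_ne_zero.2 (marginal_one_ne_top π u))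
    (mul_ne_zero ht (gaussianPDF_pos t one_ne_zero u).ne')

/-- All atoms but θ' are dropped from the posterior mixture. Under a product prior the posterior
mass of θ' is the product of the coordinate masses, so its negative logarithm is a sum. -/
theorem klRisk_bayesDensity_pi_le {n : ℕ} {r : ℝ≥0} (hr : r ≠ 0) (θ θ' : Fin n → ℝ)
    (hθ' : ∀ i, π {θ' i} ≠ 0) :
    klRisk r θ (bayesDensity r (Measure.pi fun _ => π)) ≤ ∑ i, coordRisk r π (θ i) (θ' i) := by
  set Q : Measure (Fin n → ℝ) := Measure.pi fun _ => π
  have hpred := isPredictiveDensity_bayesDensity Q hr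
  have hmarg : ∀ x : Fin n → ℝ, ∫⁻ s, gaussianDensity 1 s x ∂Q
      = ∏ i, ∫⁻ s, gaussianPDF s 1 (x i) ∂π := fun x =>
    lintegral_pi_prod fun i => measurable_gaussianPDF_left 1 (x i)
  have hw : ∀ x : Fin n → ℝ, ∏ i, atomWeight π (θ' i) (x i)
      = (∫⁻ s, gaussianDensity 1 s x ∂Q)⁻¹ * (Q {θ'} * gaussianDensity 1 θ' x) := by
    intro x
    simp only [atomWeight]
    rw [Finset.prod_mul_distrib, Finset.prod_mul_distrib, hmarg, Measure.pi_singleton,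
      ENNReal.prod_inv_distrib]
    · rfl
    · intro i _ j _ _
      exact Or.inr (marginal_one_ne_top π _)
  have hloss : ∀ x, klLoss r θ (bayesDensity r Q x)
      ≤ ∑ i, (ENNReal.ofReal ((θ i - θ' i) ^ 2 / (2 * (r : ℝ)))
        + ENNReal.ofReal (-Real.log (atomWeight π (θ' i) (x i)).toReal)) := by
    intro x
    have hpos : ∀ i, 0 < (atomWeight π (θ' i) (x i)).toReal := fun i =>
      ENNReal.toReal_pos (atomWeight_ne_zero π (hθ' i) _) (atomWeight_ne_top π _ _)
    have hWof : ENNReal.ofReal (∏ i, (atomWeight π (θ' i) (x i)).toReal)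
        = ∏ i, atomWeight π (θ' i) (x i) := by
      rw [ENNReal.ofReal_prod_of_nonneg fun _ _ => ENNReal.toReal_nonneg]
      exact Finset.prod_congr rfl fun i _ => ENNReal.ofReal_toReal (atomWeight_ne_top π _ _)
    refine (klLoss_le_of_mul_le hr θ θ' (q := bayesDensity r Q x)
      (hpred.measurable_apply x)
      (hpred.lintegral_eq_one x) (W := ∏ i, (atomWeight π (θ' i) (x i)).toReal)
      (Finset.prod_pos fun i _ => hpos i) fun y => ?_).trans ?_
    · rw [hWof, hw, bayesDensity_eq, mul_assoc, mul_assoc]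
      gcongr
      exact lintegral_mul_singleton_le Q
        (fun s => gaussianDensity 1 s x * gaussianDensity r s y) θ'
    · rw [Real.log_prod fun i _ => (hpos i).ne', ← Finset.sum_neg_distrib,
        ← Finset.sum_add_distrib]
      simp_rw [← ENNReal.ofReal_add (div_nonneg (sq_nonneg (θ _ - θ' _))
        (by positivity : (0 : ℝ) ≤ 2 * (r : ℝ))) (neg_nonneg.2 (log_atomWeight_nonpos π _ _))]
      rw [← ENNReal.ofReal_sum_of_nonneg fun i _ => add_nonneg (by positivity)
        (neg_nonneg.2 (log_atomWeight_nonpos π _ _))]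
      refine ENNReal.ofReal_le_ofReal (Finset.sum_le_sum fun i _ => ?_)
      rw [add_comm]
  have hmeas : ∀ i, Measurable fun u : ℝ =>
      ENNReal.ofReal (-Real.log (atomWeight π (θ' i) u).toReal) := fun i =>
    ((measurable_atomWeight π (θ' i)).ennreal_toReal.log.neg).ennreal_ofReal
  rw [klRisk]
  refine (lintegral_mono hloss).trans ?_
  rw [lintegral_finsetSum]
  · refine Finset.sum_le_sum fun i _ => ?_
    rw [lintegral_add_left measurable_const, coordRisk]
    simp only [lintegral_const, measure_univ, mul_one]
    gcongr
    rw [← (measurePreserving_eval (fun i => gaussianReal (θ i) 1) i).lintegral_comp (hmeas i)]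
    rfl
  · exact fun i _ => measurable_const.add ((hmeas i).comp (measurable_pi_apply i))

/-- Uses -log w ≤ 1/w - 1. The density of N(t, 1) cancels in the mean of 1/w, which leaves the total
mass of the marginal divided by π {t}. -/
theorem coordRisk_zero_le (r : ℝ≥0) (t : ℝ) (ht : π {t} ≠ 0) :
    coordRisk r π t t ≤ (π {t})⁻¹ - 1 := by
  have hW : ∀ u, atomWeight π t u ≠ 0 := atomWeight_ne_zero π ht
  have hle : ∀ u, ENNReal.ofReal (-Real.log (atomWeight π t u).toReal)
      ≤ (atomWeight π t u)⁻¹ - 1 := by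
    intro u
    have hpos := ENNReal.toReal_pos (hW u) (atomWeight_ne_top π t u)
    have h1 := Real.log_le_sub_one_of_pos (inv_pos.2 hpos)
    rw [Real.log_inv] at h1
    refine (ENNReal.ofReal_le_ofReal h1).trans ?_
    rw [ENNReal.ofReal_sub _ zero_le_one, ENNReal.ofReal_inv_of_pos hpos,
      ENNReal.ofReal_toReal (atomWeight_ne_top π t u), ENNReal.ofReal_one]
  have hint : ∫⁻ u, (atomWeight π t u)⁻¹ ∂(gaussianReal t 1) = (π {t})⁻¹ := by
    rw [gaussianReal_of_var_ne_zero _ one_ne_zero]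
    refine (lintegral_withDensity_eq_lintegral_mul _ (measurable_gaussianPDF t 1)
        (measurable_atomWeight π t).inv).trans ?_
    have : ∀ u, (gaussianPDF t 1 * (atomWeight π t)⁻¹) u
        = (π {t})⁻¹ * ∫⁻ s, gaussianPDF s 1 u ∂π := by
      intro u
      have hg0 := (gaussianPDF_pos t one_ne_zero u).ne'
      have hgt := (gaussianPDF_ne_top (μ := t) (v := 1) (x := u))
      simp only [Pi.mul_apply, Pi.inv_apply, atomWeight]
      rw [ENNReal.mul_inv (Or.inl (ENNReal.inv_ne_zero.2 (marginal_one_ne_top π u)))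
        (Or.inl (ENNReal.inv_ne_top.2 (marginal_one_ne_zero π u))), inv_inv,
        ENNReal.mul_inv (Or.inl ht) (Or.inl (measure_ne_top π _))]
      calc _ = (gaussianPDF t 1 u * (gaussianPDF t 1 u)⁻¹)
            * ((π {t})⁻¹ * ∫⁻ s, gaussianPDF s 1 u ∂π) := by ring
        _ = _ := by rw [ENNReal.mul_inv_cancel hg0 hgt, one_mul]
    simp_rw [this]
    rw [lintegral_const_mul _ (measurable_marginal_one π), lintegral_lintegral_swap]
    · simp [lintegral_gaussianPDF_eq_one]
    · exact (measurable_gaussianPDF_comp 1 measurable_snd measurable_fst).aemeasurable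
  rw [coordRisk, sub_self]
  simp only [ne_eq, OfNat.ofNat_ne_zero, not_false_eq_true, zero_pow, zero_div,
    ENNReal.ofReal_zero, zero_add]
  refine (lintegral_mono hle).trans ?_
  rw [lintegral_sub measurable_const (by simp)
    (ae_of_all _ fun u => ENNReal.one_le_inv.2 (atomWeight_le_one π t u)), hint]
  simp

theorem integrable_sub_sq (t : ℝ) : Integrable (fun u => (u - t) ^ 2) (gaussianReal t 1) := by
  have := (memLp_id_gaussianReal (μ := t) (v := 1) 2).sub (memLp_const t)
  exact this.integrable_sq

theorem integral_sub_sq (t : ℝ) (σ2 : ℝ≥0) : ∫ u, (u - t) ^ 2 ∂(gaussianReal t σ2) = σ2 := by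
  have h := variance_fun_id_gaussianReal (μ := t) (v := σ2)
  rw [variance_eq_integral (by fun_prop), integral_id_gaussianReal] at h
  exact h

/-- Young's inequality (u-t)(s-t) ≤ (u-t)²/(2ε) + ε(s-t)²/2 separates the noise u - t from the prior
integral. The price is 1/(2ε) in the mean and the factor 1 - ε in the exponent. -/
theorem coordRisk_le {r : ℝ≥0} (t t' : ℝ) (ht : π {t'} ≠ 0) {ε B : ℝ} (hε : 0 < ε)
    (hB : ∫⁻ s, ENNReal.ofReal (Real.exp (-((1 - ε) * (s - t) ^ 2 / 2))) ∂π
      ≤ ENNReal.ofReal (Real.exp B) * π {t'}) :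
    coordRisk r π t t' ≤ ENNReal.ofReal
      ((t - t') ^ 2 / (2 * (r : ℝ)) + (B + 1 / (2 * ε) + (t - t') ^ 2 / 2)) := by
  set V : ℝ → ℝ := fun u => B + (u - t) ^ 2 / (2 * ε)
    + ((u - t') ^ 2 - (u - t) ^ 2) / (2 * ((1 : ℝ≥0) : ℝ)) with hV
  have hB' : Integrable (fun u => B + (u - t) ^ 2 / (2 * ε)) (gaussianReal t 1) :=
    (integrable_const _).add ((integrable_sub_sq t).div_const _)
  have hVi : Integrable V (gaussianReal t 1) := hB'.add (integrable_sq_sub_sq t t' 1)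
  have hVint : ∫ u, V u ∂(gaussianReal t 1) = B + 1 / (2 * ε) + (t - t') ^ 2 / 2 := by
    simp only [hV]
    rw [integral_add hB'
      (integrable_sq_sub_sq t t' 1), integral_sq_sub_sq, integral_add (integrable_const _)
      ((integrable_sub_sq t).div_const _), integral_div, integral_sub_sq]
    simp
  have hlog : ∀ u, -Real.log (atomWeight π t' u).toReal ≤ V u := by
    intro u
    have hpos := ENNReal.toReal_pos (atomWeight_ne_zero π ht u) (atomWeight_ne_top π t' u)
    rw [← Real.log_inv, Real.log_le_iff_le_exp (inv_pos.2 hpos), ← ENNReal.toReal_inv]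
    refine ENNReal.toReal_le_of_le_ofReal (Real.exp_pos _).le ?_
    rw [atomWeight, ENNReal.mul_inv (Or.inl (ENNReal.inv_ne_zero.2 (marginal_one_ne_top π u)))
      (Or.inl (ENNReal.inv_ne_top.2 (marginal_one_ne_zero π u))), inv_inv, ← div_eq_mul_inv]
    refine ENNReal.div_le_of_le_mul ?_
    have hpt : ∀ s, gaussianPDF s 1 u ≤ ENNReal.ofReal (Real.exp ((u - t) ^ 2 / (2 * ε)))
        * gaussianPDF t 1 u * ENNReal.ofReal (Real.exp (-((1 - ε) * (s - t) ^ 2 / 2))) := by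
      intro s
      rw [gaussianPDF_eq_exp_mul s t u, mul_right_comm, ← ENNReal.ofReal_mul (Real.exp_pos _).le,
        ← Real.exp_add]
      gcongr
      have key : 0 ≤ (u - t - ε * (s - t)) ^ 2 / (2 * ε) := by positivity
      have e : (u - t - ε * (s - t)) ^ 2 / (2 * ε)
          = (u - t) ^ 2 / (2 * ε) - (u - t) * (s - t) + ε * (s - t) ^ 2 / 2 := by
        field_simp; ring
      simp only [NNReal.coe_one]
      nlinarith
    calc ∫⁻ s, gaussianPDF s 1 u ∂π
        ≤ ENNReal.ofReal (Real.exp ((u - t) ^ 2 / (2 * ε))) * gaussianPDF t 1 u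
          * ∫⁻ s, ENNReal.ofReal (Real.exp (-((1 - ε) * (s - t) ^ 2 / 2))) ∂π := by
          refine (lintegral_mono hpt).trans_eq ?_
          exact lintegral_const_mul _ (by fun_prop)
      _ ≤ ENNReal.ofReal (Real.exp ((u - t) ^ 2 / (2 * ε))) * gaussianPDF t 1 u
          * (ENNReal.ofReal (Real.exp B) * π {t'}) := by gcongr
      _ = _ := by
          rw [gaussianPDF_eq_exp_mul t t' u, hV, Real.exp_add, Real.exp_add,
            ENNReal.ofReal_mul (by positivity), ENNReal.ofReal_mul (by positivity)]
          ring
  rw [coordRisk, ENNReal.ofReal_add (by positivity), ← hVint]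
  · gcongr
    rw [ofReal_integral_eq_lintegral_ofReal hVi (ae_of_all _ fun u =>
      (neg_nonneg.2 (log_atomWeight_nonpos π t' u)).trans (hlog u))]
    exact lintegral_mono fun u => ENNReal.ofReal_le_ofReal (hlog u)
  · rw [← hVint]
    exact integral_nonneg fun u => (neg_nonneg.2 (log_atomWeight_nonpos π t' u)).trans (hlog u)

end Univariate

/-! ### A two-spacing grid

In units of `λ`, the positive support points of the bi-grid prior are `1 + ∑ l < j, gap b N l`, and
twice the negative logarithm of the mass, in units of `λ²`, grows by the squares of the gaps. -/

/-- The gaps of the grid: `N` gaps `b`, followed by gaps `1`. -/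
def gap (b : ℝ) (N l : ℕ) : ℝ := if l < N then b else 1

/-- The sum of the first `j` gaps. -/
def gapSum (b : ℝ) (N j : ℕ) : ℝ := ∑ l ∈ Finset.range j, gap b N l

/-- The sum of the squares of the first `j` gaps. -/
def gapSqSum (b : ℝ) (N j : ℕ) : ℝ := ∑ l ∈ Finset.range j, gap b N l ^ 2

section Grid

variable {b : ℝ} {N : ℕ}

theorem gapSum_succ (j : ℕ) : gapSum b N (j + 1) = gapSum b N j + gap b N j :=
  Finset.sum_range_succ _ _

theorem gapSqSum_succ (j : ℕ) : gapSqSum b N (j + 1) = gapSqSum b N j + gap b N j ^ 2 :=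
  Finset.sum_range_succ _ _

theorem gapSum_zero : gapSum b N 0 = 0 := Finset.sum_range_zero _

theorem gapSqSum_zero : gapSqSum b N 0 = 0 := Finset.sum_range_zero _

theorem gap_eq {l : ℕ} (h : l < N) : gap b N l = b := if_pos h

theorem gap_eq_one {l : ℕ} (h : N ≤ l) : gap b N l = 1 := if_neg (not_lt.2 h)

theorem gapSum_eq_mul {j : ℕ} (h : j ≤ N) : gapSum b N j = j * b := by
  rw [gapSum, Finset.sum_congr rfl fun l hl => gap_eq ((Finset.mem_range.1 hl).trans_le h)]
  simp

theorem gapSqSum_eq_mul {j : ℕ} (h : j ≤ N) : gapSqSum b N j = j * b ^ 2 := by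
  rw [gapSqSum, Finset.sum_congr rfl fun l hl => by rw [gap_eq ((Finset.mem_range.1 hl).trans_le h)]]
  simp

theorem gapSum_add (j : ℕ) : gapSum b N (N + j) = N * b + j := by
  induction j with
  | zero => simp [gapSum_eq_mul le_rfl]
  | succ j ih => rw [← add_assoc, gapSum_succ, ih, gap_eq_one (Nat.le_add_right _ _)]; push_cast; ring

theorem gapSqSum_add (j : ℕ) : gapSqSum b N (N + j) = N * b ^ 2 + j := by
  induction j with
  | zero => simp [gapSqSum_eq_mul le_rfl]
  | succ j ih =>
    rw [← add_assoc, gapSqSum_succ, ih, gap_eq_one (Nat.le_add_right _ _)]; push_cast; ring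

theorem le_gap (hb1 : b ≤ 1) (l : ℕ) : b ≤ gap b N l := by
  unfold gap; split_ifs <;> linarith

theorem gap_le_one (hb1 : b ≤ 1) (l : ℕ) : gap b N l ≤ 1 := by
  unfold gap; split_ifs <;> linarith

theorem mul_le_gapSum (hb1 : b ≤ 1) (j : ℕ) : j * b ≤ gapSum b N j := by
  have := Finset.card_nsmul_le_sum (Finset.range j) (gap b N) b fun l _ => le_gap hb1 l
  simpa [gapSum] using this

theorem gapSum_mono (hb : 0 < b) (hb1 : b ≤ 1) {i j : ℕ} (hij : i ≤ j) :
    gapSum b N i ≤ gapSum b N j :=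
  monotone_nat_of_le_succ (fun j => by
    rw [gapSum_succ]; linarith [le_gap (N := N) hb1 j]) hij

theorem gapSqSum_mono {i j : ℕ} (hij : i ≤ j) : gapSqSum b N i ≤ gapSqSum b N j :=
  monotone_nat_of_le_succ (fun j => by
    rw [gapSqSum_succ]; linarith [sq_nonneg (gap b N j)]) hij

theorem gapSum_nonneg (hb : 0 < b) (hb1 : b ≤ 1) (j : ℕ) : 0 ≤ gapSum b N j := by
  simpa [gapSum_zero] using gapSum_mono (N := N) hb hb1 (Nat.zero_le j)

theorem gapSqSum_nonneg (j : ℕ) : 0 ≤ gapSqSum b N j := by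
  simpa [gapSqSum_zero] using gapSqSum_mono (b := b) (N := N) (Nat.zero_le j)

theorem gapSqSum_sub_le_sub (hb : 0 < b) (hb1 : b ≤ 1) {i j : ℕ} (hij : i ≤ j) :
    gapSqSum b N j - gapSqSum b N i ≤ gapSum b N j - gapSum b N i := by
  induction j, hij using Nat.le_induction with
  | base => simp
  | succ j _ ih =>
    rw [gapSqSum_succ, gapSum_succ]
    nlinarith [le_gap (N := N) hb1 j, gap_le_one (N := N) hb1 j]

theorem gapSqSum_sub_le_sq (hb : 0 < b) (hb1 : b ≤ 1) {i j : ℕ} (hij : i ≤ j) :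
    gapSqSum b N j - gapSqSum b N i ≤ (gapSum b N j - gapSum b N i) ^ 2 := by
  induction j, hij using Nat.le_induction with
  | base => simp
  | succ j hj ih =>
    rw [gapSqSum_succ, gapSum_succ]
    nlinarith [le_gap (N := N) hb1 j, gapSum_mono (N := N) hb hb1 hj]

theorem exists_gapSum_le_lt (hb : 0 < b) (hb1 : b ≤ 1) {x : ℝ} (hx : 0 ≤ x) :
    ∃ j, gapSum b N j ≤ x ∧ x < gapSum b N (j + 1) := by
  have hex : ∃ j, x < gapSum b N j := by
    obtain ⟨j, hj⟩ := exists_nat_gt (x / b)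
    exact ⟨j, ((div_lt_iff₀ hb).1 hj).trans_le (mul_le_gapSum hb1 j)⟩
  classical
  have hpos : Nat.find hex ≠ 0 := by
    intro h0
    have := Nat.find_spec hex
    rw [h0, gapSum_zero] at this
    linarith
  obtain ⟨j, hj⟩ := Nat.exists_eq_succ_of_ne_zero hpos
  refine ⟨j, not_lt.1 (Nat.find_min hex (by omega)), ?_⟩
  have := Nat.find_spec hex
  rwa [hj] at this

/-- The grid point just below `x` approximates `x` well enough against any other grid point. -/
theorem floor_le_grid (hb : 0 < b) (hb1 : b ≤ 1) {κ x : ℝ} (hκ : 0 ≤ κ) {j : ℕ}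
    (h1 : gapSum b N j ≤ x) (h2 : x < gapSum b N (j + 1)) (i : ℕ) :
    gapSqSum b N j + (1 + κ) * (gapSum b N j - x) ^ 2
      ≤ gapSqSum b N i + (gapSum b N i - x) ^ 2 + κ := by
  rw [gapSum_succ] at h2
  have hd1 := gap_le_one (N := N) hb1 j
  have hy : (gapSum b N j - x) ^ 2 ≤ 1 := by nlinarith
  have hκy : κ * (gapSum b N j - x) ^ 2 ≤ κ := mul_le_of_le_one_right hκ hy
  rcases le_or_gt i j with hij | hij
  -- Below j: descending to i saves at most the square of the distance P_j - P_i between the two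
  -- points, and (x - P_i)² exceeds (x - P_j)² by at least that.
  · have := gapSqSum_sub_le_sq (N := N) hb hb1 hij
    have := gapSum_mono (N := N) hb hb1 hij
    nlinarith
  -- Above j: the penalty rises by at least the square of the gap after j, and x lies within that
  -- gap of the point j.
  · have h3 := gapSqSum_mono (b := b) (N := N) hij
    have h4 := gapSum_mono (N := N) hb hb1 hij
    rw [Nat.succ_eq_add_one] at h3 h4
    rw [gapSqSum_succ] at h3
    rw [gapSum_succ] at h4
    nlinarith [sq_nonneg (gapSum b N i - gapSum b N j - gap b N j)]

set_option maxHeartbeats 1000000 in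
/-- Some grid point approximates `x` well enough against the origin. -/
theorem exists_le_origin {r : ℝ} (hr : 0 < r) (hb : 0 < b) (hb1 : b ≤ 1)
    (hbr : b * (1 + 2 * r) ≤ 4 * r * (1 + r)) (hN1 : 1 ≤ N) (hN : 4 ≤ (N * b) ^ 2 * b)
    {x : ℝ} (hx : 0 ≤ x) :
    ∃ j, gapSqSum b N j + (1 + r⁻¹) * (gapSum b N j - x) ^ 2 ≤ x ^ 2 + 2 * x := by
  set κ := r⁻¹ with hκd
  have hκ : 0 < κ := inv_pos.2 hr
  have hκr : κ * r = 1 := inv_mul_cancel₀ hr.ne'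
  have hκb : κ * b ≤ 4 := by
    have h1 : b ≤ 4 * r := by
      by_contra! hc
      nlinarith
    calc κ * b ≤ κ * (4 * r) := by gcongr
      _ = 4 := by linarith
  obtain ⟨j, hj1, hj2⟩ := exists_gapSum_le_lt (N := N) hb hb1 hx
  rw [gapSum_succ] at hj2
  rcases Nat.eq_zero_or_pos j with rfl | hj0
  · rw [gapSum_zero, gap_eq hN1, zero_add] at hj2
    -- The point j = 0 works exactly when κx ≤ 2, that is x ≤ 2r. Beyond that the next point must
    -- take over.
    rcases le_or_gt x (2 * r) with hxr | hxr
    · refine ⟨0, ?_⟩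
      rw [gapSqSum_zero, gapSum_zero]
      have : κ * x ≤ 2 := by nlinarith
      nlinarith
    · refine ⟨1, ?_⟩
      rw [gapSqSum_eq_mul hN1, gapSum_eq_mul hN1]
      simp only [Nat.cast_one, one_mul]
      obtain ⟨s, rfl⟩ : ∃ s, x = b - s := ⟨b - x, by ring⟩
      have hs0 : 0 < s := by linarith
      have hs : s < b - 2 * r := by linarith
      have hc : (b - 2 * r) * (1 + 2 * r) ≤ 2 * r := by nlinarith
      have hw : κ * (b - 2 * r) * (1 + 2 * r) ≤ 2 := by
        calc κ * (b - 2 * r) * (1 + 2 * r) = κ * ((b - 2 * r) * (1 + 2 * r)) := by ring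
          _ ≤ κ * (2 * r) := by gcongr
          _ = 2 := by linarith
      -- With x = b - s the claim reads κs² + 2(b+1)s ≤ 2b, which is hardest at x = 2r. There it
      -- becomes an equality when b - 2r = 2r/(1+2r), that is b = 4r(1+r)/(1+2r): the origin of the
      -- inner spacing.
      have key : κ * (b - 2 * r) ^ 2 + 2 * (b + 1) * (b - 2 * r) ≤ 2 * b := by
        set w := b - 2 * r with hwd
        have hb' : b = w + 2 * r := by rw [hwd]; ring
        have hw0 : 0 ≤ w := by linarith
        have e1 : κ * w ^ 2 * (1 + 2 * r) ≤ 2 * w := by nlinarith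
        rw [hb']
        have : (κ * w ^ 2 + 2 * (w + 2 * r + 1) * w - 2 * (w + 2 * r)) * (1 + 2 * r) ≤ 0 := by
          nlinarith
        nlinarith
      have h5 : κ * s ^ 2 ≤ κ * (b - 2 * r) ^ 2 := by gcongr
      nlinarith
  · set X := gapSum b N j with hX
    have hXb : b ≤ X := by
      have := mul_le_gapSum (N := N) hb1 j
      have : (1 : ℝ) ≤ j := by exact_mod_cast hj0
      nlinarith
    have hQsq : gapSqSum b N j ≤ X ^ 2 := by
      simpa [gapSqSum_zero, gapSum_zero] using
        gapSqSum_sub_le_sq (N := N) hb hb1 (Nat.zero_le j)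
    have hQX : gapSqSum b N j ≤ X := by
      simpa [gapSqSum_zero, gapSum_zero] using
        gapSqSum_sub_le_sub (N := N) hb hb1 (Nat.zero_le j)
    rcases lt_or_ge j N with hjN | hjN
    · rw [gap_eq hjN] at hj2
      -- Take the nearer end of the gap: the extra cost κ(b/2)² is at most b because κb ≤ 4.
      rcases le_or_gt (x - X) (b / 2) with hy | hy
      · refine ⟨j, ?_⟩
        obtain ⟨y, rfl⟩ : ∃ y, x = X + y := ⟨x - X, by ring⟩
        have hy0 : 0 ≤ y := by linarith
        have hyb : y ≤ b / 2 := by linarith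
        have h6 : κ * y ^ 2 ≤ b := by
          calc κ * y ^ 2 ≤ κ * (b / 2) ^ 2 := by gcongr
            _ = κ * b * b / 4 := by ring
            _ ≤ b := by nlinarith
        nlinarith
      · refine ⟨j + 1, ?_⟩
        rw [gapSqSum_eq_mul hjN, gapSum_eq_mul hjN]
        rw [gapSum_eq_mul hjN.le] at hX
        push_cast
        have hj1' : (1 : ℝ) ≤ j := by exact_mod_cast hj0
        obtain ⟨s, rfl⟩ : ∃ s, x = (j + 1) * b - s := ⟨(j + 1) * b - x, by ring⟩
        have hs0 : 0 ≤ s := by linarith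
        have hs : s ≤ b / 2 := by linarith
        have h6 : κ * s ^ 2 ≤ b := by
          calc κ * s ^ 2 ≤ κ * (b / 2) ^ 2 := by gcongr
            _ = κ * b * b / 4 := by ring
            _ ≤ b := by nlinarith
        have h7 : 2 * (j + 1) * b * s ≤ (j + 1) * b * b := by
          have : 0 ≤ ((j : ℝ) + 1) * b := by positivity
          nlinarith
        have h8 : 2 * ((j + 1) * b ^ 2) ≤ ((j + 1) * b) ^ 2 := by nlinarith [sq_nonneg b]
        nlinarith
    · rw [gap_eq_one hjN] at hj2
      have hNX : N * b ≤ X := by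
        rw [← gapSum_eq_mul (b := b) le_rfl]; exact gapSum_mono hb hb1 hjN
      have hNb : 0 < N * b := by
        have : (1 : ℝ) ≤ N := by exact_mod_cast hN1
        positivity
      -- The inner zone is long enough that κ ≤ 4/b ≤ X² from here on. A distance of at most 1/2
      -- then costs at most X²/4 extra, so gaps of length 1 are affordable. This is the reason for N
      -- ≥ 2b^(-3/2).
      have hX2 : 4 ≤ X ^ 2 * b := hN.trans (by gcongr)
      have hκX : κ ≤ X ^ 2 := by
        have : κ * b ≤ X ^ 2 * b := hκb.trans hX2
        exact le_of_mul_le_mul_right this hb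
      have hX4 : 4 ≤ X ^ 2 := by nlinarith [sq_nonneg X]
      have hX2' : 2 ≤ X := by nlinarith
      rcases le_or_gt (x - X) (1 / 2) with hy | hy
      · refine ⟨j, ?_⟩
        obtain ⟨y, rfl⟩ : ∃ y, x = X + y := ⟨x - X, by ring⟩
        have hy0 : 0 ≤ y := by linarith
        have h6 : κ * y ^ 2 ≤ X ^ 2 / 4 := by
          calc κ * y ^ 2 ≤ X ^ 2 * (1 / 2) ^ 2 := by gcongr; linarith
            _ = X ^ 2 / 4 := by ring
        nlinarith
      · refine ⟨j + 1, ?_⟩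
        rw [gapSqSum_succ, gapSum_succ, gap_eq_one hjN]
        obtain ⟨s, rfl⟩ : ∃ s, x = X + 1 - s := ⟨X + 1 - x, by ring⟩
        have hs0 : 0 ≤ s := by linarith
        have hs : s ≤ 1 / 2 := by linarith
        have h6 : κ * s ^ 2 ≤ X ^ 2 / 4 := by
          calc κ * s ^ 2 ≤ X ^ 2 * (1 / 2) ^ 2 := by gcongr
            _ = X ^ 2 / 4 := by ring
        have h7 : X * s ≤ X * (1 / 2) := by gcongr
        have e1 : (X + 1 - s) ^ 2 = X ^ 2 + 2 * X + 1 - 2 * (X * s) - 2 * s + s ^ 2 := by ring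
        have e2 : (1 + κ) * (X + 1 - (X + 1 - s)) ^ 2 = s ^ 2 + κ * s ^ 2 := by ring
        rw [e1, e2]
        linarith

/-- The support points in units of `λ`: the origin and the positive grid points. -/
def scaledPoint (b : ℝ) (N : ℕ) : Option ℕ → ℝ
  | none => 0
  | some j => 1 + gapSum b N j

/-- Twice the negative logarithm of the mass of a support point, in units of `λ²`. -/
def scaledPenalty (r b : ℝ) (N : ℕ) : Option ℕ → ℝ
  | none => 0
  | some j => 1 + r⁻¹ + gapSqSum b N j

theorem scaledPoint_nonneg (hb : 0 < b) (hb1 : b ≤ 1) (o : Option ℕ) :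
    0 ≤ scaledPoint b N o := by
  cases o with
  | none => exact le_rfl
  | some j => exact add_nonneg zero_le_one (gapSum_nonneg hb hb1 j)

/-- The grid point just below τ competes with every grid point, and `exists_le_origin` supplies one
that competes with the origin; the cheaper of the two does both. The second bound, only linear in
the distance, lets `exists_scaledPoint_eps` weaken the quadratic term. -/
theorem exists_scaledPoint {r : ℝ} (hr : 0 < r) (hb : 0 < b) (hb1 : b ≤ 1)
    (hbr : b * (1 + 2 * r) ≤ 4 * r * (1 + r)) (hN1 : 1 ≤ N) (hN : 4 ≤ (N * b) ^ 2 * b)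
    {τ : ℝ} (hτ : 0 ≤ τ) :
    ∃ o, ∀ o',
      scaledPenalty r b N o + (1 + r⁻¹) * (scaledPoint b N o - τ) ^ 2
          ≤ scaledPenalty r b N o' + (scaledPoint b N o' - τ) ^ 2 + r⁻¹ ∧
      scaledPenalty r b N o + (1 + r⁻¹) * (scaledPoint b N o - τ) ^ 2
          ≤ scaledPenalty r b N o' + |scaledPoint b N o' - τ| + 1 + 2 * (1 + r⁻¹) := by
  have hκ : 0 < r⁻¹ := inv_pos.2 hr
  rcases le_or_gt τ 1 with h1 | h1
  -- Here the origin costs at most 1 + κ, already the least penalty of a positive grid point.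
  · refine ⟨none, fun o' => ?_⟩
    have hsq : τ ^ 2 ≤ 1 := by nlinarith
    cases o' with
    | none =>
      simp only [scaledPenalty, scaledPoint]
      constructor
      · nlinarith
      · nlinarith [abs_nonneg (0 - τ)]
    | some i =>
      have hQ := gapSqSum_nonneg (b := b) (N := N) i
      simp only [scaledPenalty, scaledPoint]
      constructor
      · nlinarith [sq_nonneg (1 + gapSum b N i - τ)]
      · nlinarith [abs_nonneg (1 + gapSum b N i - τ)]
  · obtain ⟨j, hj1, hj2⟩ := exists_gapSum_le_lt (N := N) hb hb1 (x := τ - 1) (by linarith)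
    obtain ⟨k, hk⟩ := exists_le_origin hr hb hb1 hbr hN1 hN (x := τ - 1) (by linarith)
    have hfloor := floor_le_grid hb hb1 hκ.le hj1 hj2
    have hy : (1 + gapSum b N j - τ) ^ 2 ≤ 1 := by
      rw [gapSum_succ] at hj2
      have := gap_le_one (N := N) hb1 j
      nlinarith
    have hA : ∀ o', scaledPenalty r b N (some j) + (1 + r⁻¹) * (scaledPoint b N (some j) - τ) ^ 2
          ≤ scaledPenalty r b N o' + |scaledPoint b N o' - τ| + 1 + 2 * (1 + r⁻¹) := by
      intro o'
      have hay : (1 + r⁻¹) * (1 + gapSum b N j - τ) ^ 2 ≤ 1 + r⁻¹ :=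
        mul_le_of_le_one_right (by linarith) hy
      cases o' with
      | none =>
        simp only [scaledPenalty, scaledPoint]
        have := gapSqSum_sub_le_sub (N := N) hb hb1 (Nat.zero_le j)
        rw [gapSqSum_zero, gapSum_zero] at this
        have := neg_le_abs (0 - τ)
        linarith
      | some i =>
        simp only [scaledPenalty, scaledPoint]
        rcases le_total i j with hij | hij
        · have := gapSqSum_sub_le_sub (N := N) hb hb1 hij
          have := neg_le_abs (1 + gapSum b N i - τ)
          linarith
        · have := gapSqSum_mono (b := b) (N := N) hij
          have := abs_nonneg (1 + gapSum b N i - τ)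
          linarith
    have hB : scaledPenalty r b N (some k) + (1 + r⁻¹) * (scaledPoint b N (some k) - τ) ^ 2
          ≤ scaledPenalty r b N none + (scaledPoint b N none - τ) ^ 2 + r⁻¹ := by
      simp only [scaledPenalty, scaledPoint]
      have e : (1 + gapSum b N k - τ) = gapSum b N k - (τ - 1) := by ring
      rw [e]; nlinarith
    have hC : ∀ i, scaledPenalty r b N (some j) + (1 + r⁻¹) * (scaledPoint b N (some j) - τ) ^ 2
          ≤ scaledPenalty r b N (some i) + (scaledPoint b N (some i) - τ) ^ 2 + r⁻¹ := by
      intro i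
      have := hfloor i
      simp only [scaledPenalty, scaledPoint]
      have e : ∀ l, (1 + gapSum b N l - τ) = gapSum b N l - (τ - 1) := fun l => by ring
      rw [e, e]; linarith
    rcases le_total
      (scaledPenalty r b N (some j) + (1 + r⁻¹) * (scaledPoint b N (some j) - τ) ^ 2)
      (scaledPenalty r b N (some k) + (1 + r⁻¹) * (scaledPoint b N (some k) - τ) ^ 2) with h | h
    · refine ⟨some j, fun o' => ⟨?_, hA o'⟩⟩
      cases o' with
      | none => exact h.trans hB
      | some i => exact hC i
    · refine ⟨some k, fun o' => ⟨?_, h.trans (hA o')⟩⟩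
      cases o' with
      | none => exact hB
      | some i => exact h.trans (hC i)

/-- The two bounds of `exists_scaledPoint` are combined with weights 1 - 4ε and 4ε, using (1-4ε)d² +
4εd ≤ (1-2ε)d² + 2ε. -/
theorem exists_scaledPoint_eps {r : ℝ} (hr : 0 < r) (hb : 0 < b) (hb1 : b ≤ 1)
    (hbr : b * (1 + 2 * r) ≤ 4 * r * (1 + r)) (hN1 : 1 ≤ N) (hN : 4 ≤ (N * b) ^ 2 * b)
    {τ ε : ℝ} (hτ : 0 ≤ τ) (hε : 0 ≤ ε) (hε4 : ε ≤ 1 / 4) :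
    ∃ o, ∀ o',
      scaledPenalty r b N o + (1 + r⁻¹) * (scaledPoint b N o - τ) ^ 2
          ≤ scaledPenalty r b N o' + (1 - 2 * ε) * (scaledPoint b N o' - τ) ^ 2 + r⁻¹
            + ε * (14 + 8 * r⁻¹) := by
  have hκ : 0 < r⁻¹ := inv_pos.2 hr
  obtain ⟨o, ho⟩ := exists_scaledPoint hr hb hb1 hbr hN1 hN hτ
  refine ⟨o, fun o' => ?_⟩
  obtain ⟨h1, h2⟩ := ho o'
  have h1' := mul_le_mul_of_nonneg_left h1 (by linarith : 0 ≤ 1 - 4 * ε)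
  have h2' := mul_le_mul_of_nonneg_left h2 (by linarith : 0 ≤ 4 * ε)
  have h3 : 2 * ε * 0 ≤ 2 * ε * (|scaledPoint b N o' - τ| - 1) ^ 2 :=
    mul_le_mul_of_nonneg_left (sq_nonneg _) (by linarith)
  have h4 : |scaledPoint b N o' - τ| ^ 2 = (scaledPoint b N o' - τ) ^ 2 := sq_abs _
  have h5 : 0 ≤ ε * r⁻¹ := by positivity
  nlinarith

end Grid

/-! ### Gaussian sums over separated points -/

/-- The bounded function y/(1+|y|) has unit increments of order 1/y², enough to dominate exp(-y²).
Gaussian sums over points at least 1 apart are thus bounded by a telescoping sum, uniformly in their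
location. -/
theorem exp_neg_sq_le_increment (y : ℝ) :
    Real.exp (-y ^ 2) ≤ 4 * ((y + 1) / (1 + |y + 1|) - y / (1 + |y|)) := by
  have he : Real.exp (-y ^ 2) ≤ 1 / (1 + y ^ 2) := by
    rw [Real.exp_neg, ← one_div]
    have := Real.add_one_le_exp (y ^ 2)
    gcongr; linarith
  refine he.trans ?_
  rcases le_total 0 y with h0 | h0
  · rw [abs_of_nonneg h0, abs_of_nonneg (by linarith : 0 ≤ y + 1)]
    have : (y + 1) / (1 + (y + 1)) - y / (1 + y) = 1 / ((1 + (y + 1)) * (1 + y)) := by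
      field_simp; ring
    rw [this, mul_one_div, div_le_div_iff₀ (by positivity) (by positivity)]
    nlinarith [sq_nonneg (y - 1)]
  · rw [abs_of_nonpos h0]
    rcases le_total 0 (y + 1) with h1 | h1
    · rw [abs_of_nonneg h1]
      have e1 : 1 / (1 + y ^ 2) ≤ 1 := by
        rw [div_le_one (by positivity)]; nlinarith
      have e2 : (y + 1) / 2 ≤ (y + 1) / (1 + (y + 1)) :=
        div_le_div_of_nonneg_left h1 (by linarith) (by linarith)
      have e3 : -y / 2 ≤ -y / (1 + -y) :=
        div_le_div_of_nonneg_left (by linarith) (by linarith) (by linarith)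
      have e4 : y / (1 + -y) = -(-y / (1 + -y)) := by ring
      rw [e4]; linarith
    · rw [abs_of_nonpos h1]
      have hp : 0 < 1 + -y := by linarith
      have hq : 0 < 1 + -(y + 1) := by linarith
      have : (y + 1) / (1 + -(y + 1)) - y / (1 + -y) = 1 / ((1 + -(y + 1)) * (1 + -y)) := by
        field_simp; ring
      rw [this, mul_one_div, div_le_div_iff₀ (by positivity) (by positivity)]
      nlinarith [sq_nonneg (y + 1)]

theorem div_one_add_abs_mono {x y : ℝ} (h : x ≤ y) : x / (1 + |x|) ≤ y / (1 + |y|) := by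
  rw [div_le_div_iff₀ (by positivity) (by positivity)]
  rcases le_total 0 x with hx | hx
  · rw [abs_of_nonneg hx, abs_of_nonneg (hx.trans h)]; nlinarith
  · rw [abs_of_nonpos hx]
    rcases le_total 0 y with hy | hy
    · rw [abs_of_nonneg hy]; nlinarith [mul_nonneg (neg_nonneg.2 hx) hy]
    · rw [abs_of_nonpos hy]; nlinarith

theorem tsum_exp_neg_sq_le {y : ℕ → ℝ} (hy : ∀ j, y j + 1 ≤ y (j + 1)) :
    ∑' j, ENNReal.ofReal (Real.exp (-y j ^ 2)) ≤ 8 := by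
  refine ENNReal.tsum_le_of_sum_range_le fun n => ?_
  rw [← ENNReal.ofReal_sum_of_nonneg fun _ _ => (Real.exp_pos _).le]
  have h1 : ∀ z : ℝ, |z / (1 + |z|)| ≤ 1 := fun z => by
    rw [abs_div, abs_of_nonneg (by positivity : (0 : ℝ) ≤ 1 + |z|), div_le_one (by positivity)]
    linarith
  have h2 : ∑ j ∈ Finset.range n, Real.exp (-y j ^ 2)
      ≤ 4 * (y n / (1 + |y n|) - y 0 / (1 + |y 0|)) := by
    rw [← Finset.sum_range_sub (fun j => y j / (1 + |y j|)), Finset.mul_sum]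
    refine Finset.sum_le_sum fun j _ => (exp_neg_sq_le_increment (y j)).trans ?_
    have := div_one_add_abs_mono (hy j)
    linarith
  have h3 := abs_le.1 (h1 (y n))
  have h4 := abs_le.1 (h1 (y 0))
  calc ENNReal.ofReal (∑ j ∈ Finset.range n, Real.exp (-y j ^ 2)) ≤ ENNReal.ofReal 8 :=
        ENNReal.ofReal_le_ofReal (by linarith)
    _ = 8 := by norm_num

/-! ### The bi-grid prior as a weighted grid -/

/-- The number of inner gaps of the bi-grid prior. -/
def innerGaps (r : ℝ) : ℕ := ⌈2 * innerFactor r ^ (-(3 / 2) : ℝ)⌉₊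

/-! ### The parameters b, K, v and λ. -/

section Parameters

variable {r : ℝ}

theorem innerCard_eq : innerCard r = innerGaps r + 1 := add_comm _ _

theorem innerFactor_pos (hr : 0 < r) : 0 < innerFactor r := lt_min (by positivity) one_pos

theorem innerFactor_le_one : innerFactor r ≤ 1 := min_le_right _ _

theorem innerFactor_mul_le (hr : 0 < r) : innerFactor r * (1 + 2 * r) ≤ 4 * r * (1 + r) :=
  (le_div_iff₀ (by positivity)).1 (min_le_left _ _)

theorem one_le_innerGaps (hr : 0 < r) : 1 ≤ innerGaps r := by
  have := Real.rpow_pos_of_pos (innerFactor_pos hr) (-(3 / 2) : ℝ)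
  exact Nat.one_le_iff_ne_zero.2 (Nat.ceil_pos.2 (by positivity)).ne'

theorem four_le_innerGaps (hr : 0 < r) :
    4 ≤ ((innerGaps r : ℝ) * innerFactor r) ^ 2 * innerFactor r := by
  have hb := innerFactor_pos hr
  set b := innerFactor r
  have h1 : 2 * b ^ (-(3 / 2) : ℝ) ≤ innerGaps r := Nat.le_ceil _
  have h2 : (b ^ (-(3 / 2) : ℝ)) ^ 2 * b ^ 3 = 1 := by
    rw [← Real.rpow_natCast, ← Real.rpow_natCast, ← Real.rpow_mul hb.le, ← Real.rpow_add hb]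
    norm_num
  have h3 : 0 < b ^ (-(3 / 2) : ℝ) := Real.rpow_pos_of_pos hb _
  calc (4 : ℝ) = (2 * b ^ (-(3 / 2) : ℝ)) ^ 2 * b ^ 3 := by rw [mul_pow, mul_assoc, h2]; norm_num
    _ ≤ (innerGaps r : ℝ) ^ 2 * b ^ 3 := by gcongr
    _ = _ := by ring

theorem oracleVar_pos (hr : 0 < r) : 0 < oracleVar r := by unfold oracleVar; positivity

theorem log_eq_neg_spacing_sq (hr : 0 < r) {η : ℝ} (h0 : 0 < η) (h1 : η ≤ 1) :
    oracleVar r * Real.log η = -(spacing r η ^ 2 / 2) := by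
  have hlog := Real.log_nonpos h0.le h1
  have hv := oracleVar_pos hr
  rw [spacing, Real.log_rpow h0, Real.sq_sqrt]
  · ring
  · nlinarith

theorem eq_exp_spacing (hr : 0 < r) {η : ℝ} (h0 : 0 < η) (h1 : η ≤ 1) :
    η = Real.exp (-(spacing r η ^ 2 / 2 * (1 + r⁻¹))) := by
  rw [← neg_mul, ← log_eq_neg_spacing_sq hr h0 h1, oracleVar, mul_comm, ← mul_assoc,
    mul_inv_cancel₀ (by positivity), one_mul, Real.exp_log h0]

theorem rpow_eq_exp_spacing (hr : 0 < r) {η : ℝ} (h0 : 0 < η) (h1 : η ≤ 1) (x : ℝ) :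
    η ^ (oracleVar r * x) = Real.exp (-(spacing r η ^ 2 / 2 * x)) := by
  rw [Real.rpow_def_of_pos h0, ← mul_assoc, mul_comm (Real.log η),
    log_eq_neg_spacing_sq hr h0 h1, neg_mul]

end Parameters

/-- The `j`-th positive support point of the bi-grid prior. -/
def gridPoint (r η : ℝ) (j : ℕ) : ℝ :=
  spacing r η * (1 + gapSum (innerFactor r) (innerGaps r) j)

/-- The unnormalised mass of the `j`-th positive support point. -/
def gridMass (r η : ℝ) (j : ℕ) : ℝ :=
  η ^ (oracleVar r * gapSqSum (innerFactor r) (innerGaps r) j)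

/-- The two zones are merged into one sequence indexed from 0. As K = `innerGaps r` + 1, the indices
up to `innerGaps r` give ν_1, …, ν_K, and i + K gives μ_(i+1). -/
theorem gridMass_add (r : ℝ) {η : ℝ} (h0 : 0 < η) (i : ℕ) :
    gridMass r η (i + (innerGaps r + 1))
      = η ^ (((innerCard r : ℝ) - 1) * oracleVar r * innerFactor r ^ 2)
        * η ^ (((i + 1 : ℕ) : ℝ) * oracleVar r) := by
  rw [gridMass, ← Real.rpow_add h0, show i + (innerGaps r + 1) = innerGaps r + (i + 1) by ring,
    gapSqSum_add, innerCard_eq]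
  congr 1
  push_cast; ring

theorem gridMass_of_le (r η : ℝ) {j : ℕ} (hj : j ≤ innerGaps r) :
    gridMass r η j = η ^ ((((1 + j : ℕ) : ℝ) - 1) * oracleVar r * innerFactor r ^ 2) := by
  rw [gridMass, gapSqSum_eq_mul hj]
  congr 1
  push_cast; ring

theorem gridPoint_add (r η : ℝ) (i : ℕ) :
    gridPoint r η (i + (innerGaps r + 1)) = outerPoint r η (i + 1) := by
  rw [gridPoint, show i + (innerGaps r + 1) = innerGaps r + (i + 1) by ring, gapSum_add,
    outerPoint, innerPoint, innerCard_eq]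
  push_cast; ring

theorem gridPoint_of_le (r η : ℝ) {j : ℕ} (hj : j ≤ innerGaps r) :
    gridPoint r η j = innerPoint r η (1 + j) := by
  rw [gridPoint, gapSum_eq_mul hj, innerPoint]
  push_cast; ring

theorem ennreal_sum_add_tsum_nat_add (f : ℕ → ℝ≥0∞) (k : ℕ) :
    ∑ i ∈ Finset.range k, f i + ∑' i, f (i + k) = ∑' i, f i :=
  Summable.sum_add_tsum_nat_add' ENNReal.summable

theorem biGridPos_eq_sum (r : ℝ) {η : ℝ} (h0 : 0 < η) :
    biGridPos r η = ENNReal.ofReal (normConst r η) •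
      Measure.sum fun j => ENNReal.ofReal (gridMass r η j) • Measure.dirac (gridPoint r η j) := by
  rw [biGridPos]
  congr 1
  ext S hS
  have hsplit := ennreal_sum_add_tsum_nat_add
    (fun j => ENNReal.ofReal (gridMass r η j) * Measure.dirac (gridPoint r η j) S)
    (innerGaps r + 1)
  rw [Measure.sum_apply _ hS]
  simp only [Measure.add_apply, Measure.smul_apply, Measure.finsetSum_apply, smul_eq_mul,
    Measure.sum_apply _ hS]
  rw [← hsplit, ← Finset.Ico_add_one_right_eq_Icc, Finset.sum_Ico_eq_sum_range,
    ← ENNReal.tsum_mul_left]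
  congr 1
  · rw [innerCard_eq, Nat.add_sub_cancel]
    refine Finset.sum_congr rfl fun j hj => ?_
    have hj' : j ≤ innerGaps r := Nat.lt_succ_iff.1 (Finset.mem_range.1 hj)
    rw [gridMass_of_le r η hj', gridPoint_of_le r η hj']
  · refine tsum_congr fun i => ?_
    rw [gridMass_add r h0, gridPoint_add, ENNReal.ofReal_mul (Real.rpow_pos_of_pos h0 _).le,
      mul_assoc (ENNReal.ofReal _)]

/-- The total mass of the unnormalised one-sided bi-grid measure. -/
def totalMass (r η : ℝ) : ℝ :=
  (1 - η ^ (innerFactor r ^ 2 * oracleVar r * (innerCard r : ℝ)))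
      / (1 - η ^ (innerFactor r ^ 2 * oracleVar r))
    + η ^ (innerFactor r ^ 2 * oracleVar r * ((innerCard r : ℝ) - 1) + oracleVar r)
      / (1 - η ^ oracleVar r)

theorem normConst_eq_inv (r η : ℝ) : normConst r η = (totalMass r η)⁻¹ := rfl

theorem rpow_exponent_lt_one {r : ℝ} (hr : 0 < r) {η : ℝ} (h0 : 0 < η) (h1 : η < 1) :
    η ^ (innerFactor r ^ 2 * oracleVar r) < 1 ∧ η ^ oracleVar r < 1 := by
  have hb := innerFactor_pos hr
  have hv := oracleVar_pos hr
  exact ⟨Real.rpow_lt_one h0.le h1 (by positivity), Real.rpow_lt_one h0.le h1 hv⟩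

theorem tsum_gridMass {r : ℝ} (hr : 0 < r) {η : ℝ} (h0 : 0 < η) (h1 : η < 1) :
    ∑' j, ENNReal.ofReal (gridMass r η j) = ENNReal.ofReal (totalMass r η) := by
  obtain ⟨hq, hp⟩ := rpow_exponent_lt_one hr h0 h1
  have hp0 := Real.rpow_pos_of_pos h0 (oracleVar r)
  have hm : ∀ j, 0 ≤ gridMass r η j := fun j => (Real.rpow_pos_of_pos h0 _).le
  rw [← ennreal_sum_add_tsum_nat_add _ (innerGaps r + 1),
    ← ENNReal.ofReal_sum_of_nonneg fun j _ => hm j]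
  have hout : (fun i => gridMass r η (i + (innerGaps r + 1)))
      = fun i => η ^ (innerFactor r ^ 2 * oracleVar r * ((innerCard r : ℝ) - 1) + oracleVar r)
        * (η ^ oracleVar r) ^ i := by
    ext i
    rw [gridMass_add r h0, ← Real.rpow_add h0, ← Real.rpow_mul_natCast h0.le, ← Real.rpow_add h0]
    congr 1
    push_cast; ring
  have hin : ∀ j ∈ Finset.range (innerGaps r + 1), gridMass r η j
      = (η ^ (innerFactor r ^ 2 * oracleVar r)) ^ j := by
    intro j hj
    rw [gridMass_of_le r η (Nat.lt_succ_iff.1 (Finset.mem_range.1 hj)),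
      ← Real.rpow_mul_natCast h0.le]
    congr 1
    push_cast; ring
  have hgeo := summable_geometric_of_lt_one hp0.le hp
  have hsum : Summable fun i => gridMass r η (i + (innerGaps r + 1)) := by
    rw [hout]; exact hgeo.mul_left _
  rw [← ENNReal.ofReal_tsum_of_nonneg (fun i => hm _) hsum, ← ENNReal.ofReal_add
    (Finset.sum_nonneg fun j _ => hm j) (tsum_nonneg fun i => hm _), hout, tsum_mul_left,
    tsum_geometric_of_lt_one hp0.le hp, Finset.sum_congr rfl hin, geom_sum_eq hq.ne, totalMass]
  congr 2
  rw [← Real.rpow_mul_natCast h0.le, innerCard_eq, ← neg_div_neg_eq, neg_sub, neg_sub]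

theorem one_le_totalMass {r : ℝ} (hr : 0 < r) {η : ℝ} (h0 : 0 < η) (h1 : η < 1) :
    1 ≤ totalMass r η := by
  obtain ⟨hq, hp⟩ := rpow_exponent_lt_one hr h0 h1
  have hb := innerFactor_pos hr
  have hv := oracleVar_pos hr
  have h2 : η ^ (innerFactor r ^ 2 * oracleVar r * (innerCard r : ℝ))
      ≤ η ^ (innerFactor r ^ 2 * oracleVar r) := by
    refine Real.rpow_le_rpow_of_exponent_ge h0 h1.le ?_
    have : (1 : ℝ) ≤ innerCard r := by rw [innerCard_eq]; push_cast; linarith [(innerGaps r).cast_nonneg (α := ℝ)]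
    exact le_mul_of_one_le_right (by positivity) this
  have h3 : 1 ≤ (1 - η ^ (innerFactor r ^ 2 * oracleVar r * (innerCard r : ℝ)))
      / (1 - η ^ (innerFactor r ^ 2 * oracleVar r)) := by
    rw [one_le_div (by linarith)]; linarith
  have h4 : 0 ≤ η ^ (innerFactor r ^ 2 * oracleVar r * ((innerCard r : ℝ) - 1) + oracleVar r)
      / (1 - η ^ oracleVar r) := div_nonneg (Real.rpow_pos_of_pos h0 _).le (by linarith)
  rw [totalMass]; linarith

/-- The inner geometric sum is at most 2 and the outer one at most 1. -/
theorem totalMass_le {r : ℝ} (hr : 0 < r) {η : ℝ} (h0 : 0 < η) (h1 : η < 1)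
    (hq : η ^ (innerFactor r ^ 2 * oracleVar r) ≤ 1 / 2) (hp : η ^ oracleVar r ≤ 1 / 2) :
    totalMass r η ≤ 3 := by
  have hb := innerFactor_pos hr
  have hv := oracleVar_pos hr
  have h2 : (1 - η ^ (innerFactor r ^ 2 * oracleVar r * (innerCard r : ℝ)))
      / (1 - η ^ (innerFactor r ^ 2 * oracleVar r)) ≤ 2 := by
    rw [div_le_iff₀ (by linarith)]
    linarith [Real.rpow_pos_of_pos h0 (innerFactor r ^ 2 * oracleVar r * (innerCard r : ℝ))]
  have h3 : η ^ (innerFactor r ^ 2 * oracleVar r * ((innerCard r : ℝ) - 1) + oracleVar r)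
      ≤ η ^ oracleVar r := by
    refine Real.rpow_le_rpow_of_exponent_ge h0 h1.le ?_
    have : (0 : ℝ) ≤ (innerCard r : ℝ) - 1 := by rw [innerCard_eq]; push_cast; linarith [(innerGaps r).cast_nonneg (α := ℝ)]
    have : 0 ≤ innerFactor r ^ 2 * oracleVar r * ((innerCard r : ℝ) - 1) := by positivity
    linarith
  have h4 : η ^ (innerFactor r ^ 2 * oracleVar r * ((innerCard r : ℝ) - 1) + oracleVar r)
      / (1 - η ^ oracleVar r) ≤ 1 := by
    rw [div_le_one (by linarith)]; linarith
  rw [totalMass]; linarith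

theorem isProbabilityMeasure_biGridPos {r : ℝ} (hr : 0 < r) {η : ℝ} (h0 : 0 < η) (h1 : η < 1) :
    IsProbabilityMeasure (biGridPos r η) := by
  refine ⟨?_⟩
  have := one_le_totalMass hr h0 h1
  rw [biGridPos_eq_sum r h0, Measure.smul_apply, Measure.sum_apply _ MeasurableSet.univ]
  simp only [Measure.smul_apply, measure_univ, smul_eq_mul, mul_one]
  rw [tsum_gridMass hr h0 h1, normConst_eq_inv, ← ENNReal.ofReal_mul (by positivity),
    inv_mul_cancel₀ (by positivity), ENNReal.ofReal_one]

theorem isProbabilityMeasure_sparsePrior {ν : Measure ℝ} [IsProbabilityMeasure ν] {η : ℝ}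
    (h0 : 0 ≤ η) (h1 : η ≤ 1) : IsProbabilityMeasure (sparsePrior η ν) := by
  refine ⟨?_⟩
  have h2 : ENNReal.ofReal (η / 2) * (1 + 1) = ENNReal.ofReal η := by
    rw [one_add_one_eq_two, ← ENNReal.ofReal_ofNat 2, ← ENNReal.ofReal_mul (by linarith)]
    congr 1; ring
  have h3 : (ν.map fun t => -t) Set.univ = 1 := by
    rw [Measure.map_apply measurable_neg MeasurableSet.univ]; simp
  simp only [sparsePrior, Measure.add_apply, Measure.smul_apply, measure_univ, smul_eq_mul,
    mul_one, h3, h2]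
  rw [← ENNReal.ofReal_add (by linarith) h0]
  simp

theorem map_neg_sparsePrior (η : ℝ) (ν : Measure ℝ) :
    (sparsePrior η ν).map (fun t => -t) = sparsePrior η ν := by
  have hm : Measurable fun t : ℝ => -t := measurable_neg
  simp only [sparsePrior, Measure.map_add _ _ hm, Measure.map_smul, Measure.map_dirac' hm, neg_zero,
    Measure.map_map hm hm]
  congr 2
  rw [add_comm]
  congr 1
  have : (fun t : ℝ => -t) ∘ (fun t : ℝ => -t) = id := by ext; simp
  rw [this, Measure.map_id]

/-! ### The risk of the bi-grid Bayes predictive density in one coordinate -/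

section BiGrid

variable {r : ℝ} {η : ℝ}

theorem lintegral_biGridPrior_le (hr : 0 < r) (h0 : 0 < η) (h1 : η < 1)
    {f : ℝ → ℝ≥0∞} (hf : Measurable f) :
    ∫⁻ s, f s ∂(biGridPrior r η) ≤ f 0 + ∑' j, ENNReal.ofReal (η * gridMass r η j)
      * (f (gridPoint r η j) + f (-gridPoint r η j)) := by
  have hM := one_le_totalMass hr h0 h1
  have hpos : ∀ g : ℝ → ℝ≥0∞, Measurable g → ENNReal.ofReal (η / 2) * ∫⁻ s, g s ∂(biGridPos r η)
      ≤ ∑' j, ENNReal.ofReal (η * gridMass r η j) * g (gridPoint r η j) := by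
    intro g hg
    rw [biGridPos_eq_sum r h0, lintegral_smul_measure, lintegral_sum_measure, smul_eq_mul,
      ← mul_assoc, ← ENNReal.ofReal_mul (by linarith), ← ENNReal.tsum_mul_left]
    refine ENNReal.tsum_le_tsum fun j => ?_
    rw [lintegral_smul_measure, lintegral_dirac' _ hg, smul_eq_mul, ← mul_assoc,
      ENNReal.ofReal_mul h0.le]
    gcongr
    have : normConst r η ≤ 1 := by rw [normConst_eq_inv]; exact inv_le_one_of_one_le₀ hM
    have : 0 < normConst r η := by rw [normConst_eq_inv]; positivity
    nlinarith
  rw [biGridPrior, sparsePrior, lintegral_add_measure, lintegral_smul_measure,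
    lintegral_smul_measure, lintegral_add_measure, lintegral_map hf measurable_neg,
    lintegral_dirac' _ hf, smul_eq_mul, smul_eq_mul, mul_add]
  simp_rw [mul_add]
  rw [ENNReal.tsum_add]
  refine add_le_add ?_ (add_le_add (hpos f hf) (hpos (fun s => f (-s)) (hf.comp measurable_neg)))
  refine mul_le_of_le_one_left' ?_
  rw [ENNReal.ofReal_le_one]; linarith

theorem le_biGridPrior_singleton_gridPoint (h0 : 0 < η) (j : ℕ) :
    ENNReal.ofReal (η / 2 * normConst r η * gridMass r η j)
      ≤ biGridPrior r η {gridPoint r η j} := by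
  have hm : 0 < gridMass r η j := Real.rpow_pos_of_pos h0 _
  have h1 : ENNReal.ofReal (normConst r η) * ENNReal.ofReal (gridMass r η j)
      ≤ biGridPos r η {gridPoint r η j} := by
    rw [biGridPos_eq_sum r h0, Measure.smul_apply,
      Measure.sum_apply _ (measurableSet_singleton _), smul_eq_mul]
    gcongr
    refine le_trans ?_ (ENNReal.le_tsum j)
    simp
  simp only [biGridPrior, sparsePrior, Measure.add_apply, Measure.smul_apply, smul_eq_mul]
  rw [mul_assoc, ENNReal.ofReal_mul (by linarith), ENNReal.ofReal_mul' hm.le]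
  refine le_add_left ?_
  gcongr
  exact le_add_right h1

theorem le_biGridPrior_singleton_zero (r η : ℝ) :
    ENNReal.ofReal (1 - η) ≤ biGridPrior r η {0} := by
  simp only [biGridPrior, sparsePrior, Measure.add_apply, Measure.smul_apply, smul_eq_mul]
  refine le_add_right ?_
  simp

end BiGrid

/-! ### From the grid inequalities to the maximal risk. -/

section BiGridRisk

variable {r : ℝ} {η : ℝ}

theorem gridPoint_eq (r η : ℝ) (j : ℕ) :
    gridPoint r η j = spacing r η * scaledPoint (innerFactor r) (innerGaps r) (some j) := rfl

theorem mul_gridMass_eq_exp (hr : 0 < r) (h0 : 0 < η) (h1 : η ≤ 1) (j : ℕ) :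
    η * gridMass r η j = Real.exp (-(spacing r η ^ 2 / 2
      * scaledPenalty r (innerFactor r) (innerGaps r) (some j))) := by
  rw [gridMass, rpow_eq_exp_spacing hr h0 h1, scaledPenalty]
  nth_rewrite 1 [eq_exp_spacing hr h0 h1]
  rw [← Real.exp_add]
  congr 1; ring

/-- The prior masses of the bi-grid prior, up to a constant factor. -/
theorem le_biGridPrior_singleton (hr : 0 < r) (h0 : 0 < η) (h1 : η < 1) (hη : η ≤ 1 / 2)
    (hq : η ^ (innerFactor r ^ 2 * oracleVar r) ≤ 1 / 2) (hp : η ^ oracleVar r ≤ 1 / 2)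
    (o : Option ℕ) :
    ENNReal.ofReal (Real.exp (-(spacing r η ^ 2 / 2
        * scaledPenalty r (innerFactor r) (innerGaps r) o)) / 6)
      ≤ biGridPrior r η {spacing r η * scaledPoint (innerFactor r) (innerGaps r) o} := by
  cases o with
  | none =>
    simp only [scaledPenalty, scaledPoint, mul_zero, neg_zero, Real.exp_zero]
    refine le_trans (ENNReal.ofReal_le_ofReal ?_) (le_biGridPrior_singleton_zero r η)
    linarith
  | some j =>
    rw [← mul_gridMass_eq_exp hr h0 h1.le, ← gridPoint_eq]
    refine le_trans (ENNReal.ofReal_le_ofReal ?_) (le_biGridPrior_singleton_gridPoint h0 j)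
    have hm : 0 < gridMass r η j := Real.rpow_pos_of_pos h0 _
    -- The 6 in the statement combines this 1/3 with the 1/2 of the symmetrisation.
    have hc : 1 / 3 ≤ normConst r η := by
      rw [normConst_eq_inv, one_div]
      exact inv_anti₀ (by linarith [one_le_totalMass hr h0 h1]) (totalMass_le hr h0 h1 hq hp)
    have h2 : η / 2 * gridMass r η j * (1 / 3) ≤ η / 2 * gridMass r η j * normConst r η := by
      gcongr
    linarith

/-- The Gaussian-type integral of the bi-grid prior is controlled by any `E` which dominates
all the exponents. -/
theorem lintegral_exp_biGridPrior_le (hr : 0 < r) (h0 : 0 < η) (h1 : η < 1)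
    {τ ε E : ℝ} (hτ : 0 ≤ τ) (hε : 0 ≤ ε) (hε1 : ε ≤ 1)
    (hsep : 1 ≤ ε / 2 * (spacing r η * innerFactor r) ^ 2)
    (hE : ∀ o, scaledPenalty r (innerFactor r) (innerGaps r) o
      + (1 - 2 * ε) * (scaledPoint (innerFactor r) (innerGaps r) o - τ) ^ 2 ≥ E) :
    ∫⁻ s, ENNReal.ofReal (Real.exp (-((1 - ε) * (s - spacing r η * τ) ^ 2 / 2)))
        ∂(biGridPrior r η)
      ≤ ENNReal.ofReal (17 * Real.exp (-(spacing r η ^ 2 / 2 * E))) := by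
  set lam := spacing r η
  set b := innerFactor r
  set N := innerGaps r
  have hb : 0 < b := innerFactor_pos hr
  have hb1 : b ≤ 1 := innerFactor_le_one
  have hlam : 0 ≤ lam := Real.sqrt_nonneg _
  -- Split 1 - ε as (1 - 2ε) + ε: the first part enters E, the second remains as a Gaussian factor
  -- that makes the sum over the grid converge.
  have hterm : ∀ o, Real.exp (-(lam ^ 2 / 2 * scaledPenalty r b N o))
      * Real.exp (-((1 - ε) * (lam * scaledPoint b N o - lam * τ) ^ 2 / 2))
      ≤ Real.exp (-(lam ^ 2 / 2 * E))
        * Real.exp (-(Real.sqrt (ε / 2) * lam * (scaledPoint b N o - τ)) ^ 2) := by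
    intro o
    rw [← Real.exp_add, ← Real.exp_add, Real.exp_le_exp, mul_pow, mul_pow,
      Real.sq_sqrt (by linarith)]
    have := mul_le_mul_of_nonneg_left (hE o) (by positivity : 0 ≤ lam ^ 2 / 2)
    nlinarith
  -- Because τ ≥ 0, a negative atom is at least as far from λτ as its mirror image.
  have hneg : ∀ j, Real.exp (-((1 - ε) * (-gridPoint r η j - lam * τ) ^ 2 / 2))
      ≤ Real.exp (-((1 - ε) * (gridPoint r η j - lam * τ) ^ 2 / 2)) := by
    intro j
    rw [Real.exp_le_exp]
    have hg : 0 ≤ gridPoint r η j :=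
      mul_nonneg hlam (scaledPoint_nonneg hb hb1 (some j))
    have : 0 ≤ (1 - ε) * (gridPoint r η j * (lam * τ)) :=
      mul_nonneg (by linarith) (by positivity)
    nlinarith
  have hsum : ∑' j, ENNReal.ofReal
      (Real.exp (-(Real.sqrt (ε / 2) * lam * (scaledPoint b N (some j) - τ)) ^ 2)) ≤ 8 := by
    refine tsum_exp_neg_sq_le fun j => ?_
    simp only [scaledPoint]
    rw [gapSum_succ]
    have h2 : 1 ≤ Real.sqrt (ε / 2) * lam * b := by
      rw [← abs_of_nonneg (by positivity : 0 ≤ Real.sqrt (ε / 2) * lam * b), ← Real.sqrt_sq_eq_abs,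
        Real.one_le_sqrt, mul_assoc, mul_pow, Real.sq_sqrt (by linarith)]
      exact hsep
    have h3 : Real.sqrt (ε / 2) * lam * b ≤ Real.sqrt (ε / 2) * lam * gap b N j := by
      gcongr; exact le_gap hb1 j
    linarith
  refine (lintegral_biGridPrior_le hr h0 h1 (by fun_prop)).trans ?_
  have hzero : ENNReal.ofReal (Real.exp (-((1 - ε) * (0 - lam * τ) ^ 2 / 2)))
      ≤ ENNReal.ofReal (Real.exp (-(lam ^ 2 / 2 * E))) := by
    refine ENNReal.ofReal_le_ofReal ?_
    have := hterm none
    simp only [scaledPenalty, scaledPoint, mul_zero, neg_zero, Real.exp_zero, one_mul] at this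
    refine this.trans (mul_le_of_le_one_right (Real.exp_pos _).le ?_)
    rw [Real.exp_le_one_iff]
    linarith [sq_nonneg (Real.sqrt (ε / 2) * lam * (0 - τ))]
  have hgrid : ∀ j, ENNReal.ofReal (η * gridMass r η j)
      * (ENNReal.ofReal (Real.exp (-((1 - ε) * (gridPoint r η j - lam * τ) ^ 2 / 2)))
        + ENNReal.ofReal (Real.exp (-((1 - ε) * (-gridPoint r η j - lam * τ) ^ 2 / 2))))
      ≤ ENNReal.ofReal (2 * Real.exp (-(lam ^ 2 / 2 * E))) * ENNReal.ofReal
        (Real.exp (-(Real.sqrt (ε / 2) * lam * (scaledPoint b N (some j) - τ)) ^ 2)) := by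
    intro j
    rw [← ENNReal.ofReal_add (Real.exp_pos _).le (Real.exp_pos _).le,
      mul_gridMass_eq_exp hr h0 h1.le, ← ENNReal.ofReal_mul (Real.exp_pos _).le,
      ← ENNReal.ofReal_mul (by positivity)]
    refine ENNReal.ofReal_le_ofReal ?_
    have h2 := hterm (some j)
    have h3 := mul_le_mul_of_nonneg_left (hneg j)
      (Real.exp_pos (-(lam ^ 2 / 2 * scaledPenalty r b N (some j)))).le
    rw [gridPoint_eq] at h3 ⊢
    linarith
  calc _ ≤ ENNReal.ofReal (Real.exp (-(lam ^ 2 / 2 * E)))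
        + ∑' j, ENNReal.ofReal (2 * Real.exp (-(lam ^ 2 / 2 * E))) * ENNReal.ofReal
        (Real.exp (-(Real.sqrt (ε / 2) * lam * (scaledPoint b N (some j) - τ)) ^ 2)) :=
        add_le_add hzero (ENNReal.tsum_le_tsum hgrid)
    _ ≤ ENNReal.ofReal (Real.exp (-(lam ^ 2 / 2 * E)))
        + ENNReal.ofReal (2 * Real.exp (-(lam ^ 2 / 2 * E))) * 8 := by
        rw [ENNReal.tsum_mul_left]; gcongr
    -- 17 = 1 + 2·8: the origin, and two signs with a Gaussian sum of at most 8 each.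
    _ = _ := by
        rw [← ENNReal.ofReal_ofNat 8, ← ENNReal.ofReal_mul (by positivity),
          ← ENNReal.ofReal_add (by positivity) (by positivity)]
        congr 1; ring

/-- The spacing is large enough for the bounds on the risk. -/
structure IsLargeSpacing (r η : ℝ) : Prop where
  pos : 0 < η
  lt_one : η < 1
  four_le : 4 ≤ spacing r η
  two_le : 2 ≤ spacing r η * innerFactor r ^ 2

theorem exp_neg_le_half {x : ℝ} (hx : 1 ≤ x) : Real.exp (-x) ≤ 1 / 2 := by
  rw [Real.exp_neg, one_div]
  exact inv_anti₀ two_pos (by linarith [Real.add_one_le_exp x])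

namespace IsLargeSpacing

theorem le_half (h : IsLargeSpacing r η) (hr : 0 < r) : η ≤ 1 / 2 := by
  rw [eq_exp_spacing hr h.pos h.lt_one.le]
  refine exp_neg_le_half ?_
  have := inv_pos.2 hr
  nlinarith [h.four_le]

theorem rpow_oracleVar_le (h : IsLargeSpacing r η) (hr : 0 < r) : η ^ oracleVar r ≤ 1 / 2 := by
  have := rpow_eq_exp_spacing hr h.pos h.lt_one.le 1
  rw [mul_one] at this
  rw [this]
  refine exp_neg_le_half ?_
  nlinarith [h.four_le]

theorem rpow_inner_le (h : IsLargeSpacing r η) (hr : 0 < r) : η ^ (innerFactor r ^ 2 * oracleVar r) ≤ 1 / 2 := by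
  rw [mul_comm, rpow_eq_exp_spacing hr h.pos h.lt_one.le]
  refine exp_neg_le_half ?_
  nlinarith [h.four_le, h.two_le]

theorem exists_coordRisk_le_of_nonneg {r : ℝ≥0} (h : IsLargeSpacing r η) (hr : 0 < r) {t : ℝ}
    (ht : 0 ≤ t) :
    ∃ t', biGridPrior r η {t'} ≠ 0 ∧ coordRisk r (biGridPrior r η) t t' ≤ ENNReal.ofReal
      ((r : ℝ)⁻¹ * spacing r η ^ 2 / 2 + (15 + 8 * (r : ℝ)⁻¹) / 2 * spacing r η + Real.log 102) := by
  have hr' : (0 : ℝ) < r := hr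
  have hpr := isProbabilityMeasure_biGridPos hr' h.pos h.lt_one
  have hpr' : IsProbabilityMeasure (biGridPrior r η) :=
    isProbabilityMeasure_sparsePrior h.pos.le h.lt_one.le
  have hhalf := h.le_half hr'
  have hq := h.rpow_inner_le hr'
  have hp := h.rpow_oracleVar_le hr'
  have hlow := le_biGridPrior_singleton hr' h.pos h.lt_one hhalf hq hp
  have hlam := h.four_le
  have hlb := h.two_le
  have hlint := fun {τ ε E : ℝ} => lintegral_exp_biGridPrior_le (τ := τ) (ε := ε) (E := E)
    hr' h.pos h.lt_one
  set lam := spacing r η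
  set b := innerFactor r
  set N := innerGaps r
  have hlam0 : 0 < lam := by linarith
  obtain ⟨τ, rfl⟩ : ∃ τ, t = lam * τ := ⟨t / lam, by field_simp⟩
  have hτ : 0 ≤ τ := nonneg_of_mul_nonneg_right ht hlam0
  -- With ε = 1/λ both the noise term 1/(2ε) and the loss λ²εC/2 are of order λ. The field `four_le`
  -- gives ε ≤ 1/4, and `two_le` gives the separation ε(λb)²/2 ≥ 1.
  set ε := lam⁻¹ with hεd
  have hε0 : 0 < ε := inv_pos.2 hlam0
  have hε4 : ε ≤ 1 / 4 := by rw [hεd, one_div]; exact inv_anti₀ (by norm_num) hlam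
  have hεlam : ε * lam = 1 := inv_mul_cancel₀ hlam0.ne'
  obtain ⟨o, ho⟩ := exists_scaledPoint_eps hr' (innerFactor_pos hr') innerFactor_le_one
    (innerFactor_mul_le hr') (one_le_innerGaps hr') (four_le_innerGaps hr') hτ hε0.le hε4
  set D := (scaledPoint b N o - τ) ^ 2 with hD
  set C := 14 + 8 * (r : ℝ)⁻¹ with hC
  have hS := hlint (E := scaledPenalty r b N o + (1 + (r : ℝ)⁻¹) * D - (r : ℝ)⁻¹ - ε * C) hτ hε0.le
    (by linarith) (by nlinarith) fun o' => by linarith [ho o']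
  have hlo := hlow o
  have hne : biGridPrior r η {lam * scaledPoint b N o} ≠ 0 := by
    refine (lt_of_lt_of_le ?_ hlo).ne'
    exact ENNReal.ofReal_pos.2 (by positivity)
  refine ⟨lam * scaledPoint b N o, hne, ?_⟩
  -- 102 = 17·6: the constant of the prior integral times that of the mass of the atom.
  refine (coordRisk_le _ _ _ hne hε0 (B := Real.log 102
    - lam ^ 2 / 2 * ((1 + (r : ℝ)⁻¹) * D - (r : ℝ)⁻¹ - ε * C)) ?_).trans ?_
  · refine hS.trans ?_
    refine le_trans ?_ (mul_le_mul_right hlo _)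
    rw [← ENNReal.ofReal_mul (Real.exp_pos _).le]
    refine ENNReal.ofReal_le_ofReal (le_of_eq ?_)
    have e0 : ∀ X Y : ℝ, Real.exp (Real.log 102 - X) * (Real.exp (-Y) / 6)
        = 17 * Real.exp (-(X + Y)) := fun X Y => by
      rw [sub_eq_add_neg, Real.exp_add, Real.exp_log (by norm_num), neg_add, Real.exp_add]
      ring
    rw [e0]
    congr 2
    ring
  · refine ENNReal.ofReal_le_ofReal (le_of_eq ?_)
    have e1 : (lam * τ - lam * scaledPoint b N o) ^ 2 = lam ^ 2 * D := by rw [hD]; ring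
    have e2 : 1 / (2 * ε) = lam / 2 := by rw [hεd]; field_simp
    have e3 : lam ^ 2 * ε = lam := by rw [sq, mul_assoc, mul_comm lam ε, hεlam, mul_one]
    rw [e1, e2]
    have e4 : lam ^ 2 / 2 * ((1 + (r : ℝ)⁻¹) * D - (r : ℝ)⁻¹ - ε * C)
        = lam ^ 2 * D / 2 + lam ^ 2 * D * (r : ℝ)⁻¹ / 2 - lam ^ 2 * (r : ℝ)⁻¹ / 2
          - (lam ^ 2 * ε) * C / 2 := by ring
    have e5 : lam ^ 2 * D / (2 * r) = lam ^ 2 * D * (r : ℝ)⁻¹ / 2 := by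
      rw [div_mul_eq_div_div]; ring
    rw [e4, e3, e5, hC]
    ring

end IsLargeSpacing

/-- Reflecting the observation as well reduces negative coordinates to positive ones. -/
theorem coordRisk_neg (r : ℝ≥0) {π : Measure ℝ} [IsProbabilityMeasure π]
    (hπ : π.map (fun s => -s) = π) (t t' : ℝ) :
    coordRisk r π (-t) (-t') = coordRisk r π t t' := by
  have hpdf : ∀ s u : ℝ, gaussianPDF (-s) 1 (-u) = gaussianPDF s 1 u := fun s u => by
    simp only [gaussianPDF, gaussianPDFReal]
    congr 4
    ring
  have hatom : π {-t'} = π {t'} := by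
    conv_lhs => rw [← hπ, Measure.map_apply measurable_neg (measurableSet_singleton _)]
    congr 1
    ext s; simp
  have hmarg : ∀ u : ℝ, ∫⁻ s, gaussianPDF s 1 (-u) ∂π = ∫⁻ s, gaussianPDF s 1 u ∂π := fun u => by
    conv_lhs => rw [← hπ, lintegral_map (measurable_gaussianPDF_left 1 _) measurable_neg]
    simp_rw [hpdf]
  have hw : ∀ u, atomWeight π (-t') (-u) = atomWeight π t' u := fun u => by
    rw [atomWeight, atomWeight, hmarg, hatom, hpdf]
  have hmeas : Measurable fun u : ℝ => ENNReal.ofReal (-Real.log (atomWeight π (-t') u).toReal) :=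
    (measurable_atomWeight π (-t')).ennreal_toReal.log.neg.ennreal_ofReal
  rw [coordRisk, coordRisk, ← gaussianReal_map_neg, lintegral_map hmeas measurable_neg]
  simp_rw [hw]
  congr 2
  ring

theorem biGridPrior_singleton_neg (r η t : ℝ) :
    biGridPrior r η {-t} = biGridPrior r η {t} := by
  conv_lhs => rw [biGridPrior, ← map_neg_sparsePrior,
    Measure.map_apply measurable_neg (measurableSet_singleton _)]
  congr 1
  ext s; simp

theorem IsLargeSpacing.exists_coordRisk_le {r : ℝ≥0} (h : IsLargeSpacing r η) (hr : 0 < r)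
    (t : ℝ) :
    ∃ t', biGridPrior r η {t'} ≠ 0 ∧ coordRisk r (biGridPrior r η) t t' ≤ ENNReal.ofReal
      ((r : ℝ)⁻¹ * spacing r η ^ 2 / 2 + (15 + 8 * (r : ℝ)⁻¹) / 2 * spacing r η
        + Real.log 102) := by
  rcases le_total 0 t with ht | ht
  · exact h.exists_coordRisk_le_of_nonneg hr ht
  · obtain ⟨t', h1, h2⟩ := h.exists_coordRisk_le_of_nonneg hr (neg_nonneg.2 ht)
    refine ⟨-t', by rwa [biGridPrior_singleton_neg], ?_⟩
    have hpr := isProbabilityMeasure_biGridPos (r := r) hr h.pos h.lt_one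
    have hpr' : IsProbabilityMeasure (biGridPrior r η) :=
      isProbabilityMeasure_sparsePrior h.pos.le h.lt_one.le
    rwa [← coordRisk_neg r (π := biGridPrior r η) (map_neg_sparsePrior _ _), neg_neg]

theorem IsLargeSpacing.coordRisk_zero_le {r : ℝ≥0} (h : IsLargeSpacing r η) (hr : 0 < r) :
    coordRisk r (biGridPrior r η) 0 0 ≤ ENNReal.ofReal (2 * η) := by
  have hr' : (0 : ℝ) < r := hr
  have hpr := isProbabilityMeasure_biGridPos hr' h.pos h.lt_one
  have hpr' : IsProbabilityMeasure (biGridPrior r η) :=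
    isProbabilityMeasure_sparsePrior h.pos.le h.lt_one.le
  have hhalf := h.le_half hr'
  have h0 := le_biGridPrior_singleton_zero r η
  have hne : biGridPrior r η {0} ≠ 0 :=
    (lt_of_lt_of_le (ENNReal.ofReal_pos.2 (by linarith)) h0).ne'
  refine (SparsePrediction.coordRisk_zero_le _ r 0 hne).trans ?_
  rw [tsub_le_iff_right]
  refine (ENNReal.inv_le_inv.2 h0).trans ?_
  rw [← ENNReal.ofReal_inv_of_pos (by linarith), ← ENNReal.ofReal_one,
    ← ENNReal.ofReal_add (by linarith [h.pos]) zero_le_one]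
  refine ENNReal.ofReal_le_ofReal ?_
  rw [inv_le_iff_one_le_mul₀ (by linarith)]
  nlinarith [h.pos]

/-- The maximal risk of the bi-grid Bayes predictive density over a sparse ball. -/
theorem maxRisk_bayesDensity_biGrid_le {r : ℝ≥0} (hr : 0 < r) {n s : ℕ} (hn : 0 < n)
    (h : IsLargeSpacing r ((s : ℝ) / n)) :
    maxRisk r (sparseBall n s) (bayesDensity r (biGridPriorPi n r ((s : ℝ) / n)))
      ≤ ENNReal.ofReal (s * ((r : ℝ)⁻¹ * spacing r ((s : ℝ) / n) ^ 2 / 2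
        + (15 + 8 * (r : ℝ)⁻¹) / 2 * spacing r ((s : ℝ) / n) + (Real.log 102 + 2))) := by
  set η := (s : ℝ) / n with hη
  have hr' : (0 : ℝ) < r := hr
  have hpr := isProbabilityMeasure_biGridPos hr' h.pos h.lt_one
  have hpr' : IsProbabilityMeasure (biGridPrior r η) :=
    isProbabilityMeasure_sparsePrior h.pos.le h.lt_one.le
  choose f hf1 hf2 using fun t => h.exists_coordRisk_le hr t
  obtain ⟨T, hT⟩ : ∃ T, T = (r : ℝ)⁻¹ * spacing r η ^ 2 / 2
    + (15 + 8 * (r : ℝ)⁻¹) / 2 * spacing r η + Real.log 102 := ⟨_, rfl⟩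
  rw [← hT] at hf2
  have hlog : 0 ≤ Real.log 102 := Real.log_nonneg (by norm_num)
  have hT0 : 0 ≤ T := by
    have := h.four_le
    rw [hT]
    positivity
  have h00 : biGridPrior r η {0} ≠ 0 :=
    (lt_of_lt_of_le (ENNReal.ofReal_pos.2 (by linarith [h.lt_one]))
      (le_biGridPrior_singleton_zero r η)).ne'
  refine iSup₂_le fun θ hθ => ?_
  have hθ' : ((Finset.univ.filter fun i => θ i ≠ 0).card : ℝ) ≤ s := by
    have : hammingNorm θ ≤ s := hθ
    exact_mod_cast this
  rw [biGridPriorPi]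
  refine (klRisk_bayesDensity_pi_le _ hr.ne' θ (fun i => if θ i = 0 then 0 else f (θ i))
    fun i => ?_).trans ?_
  · split_ifs
    · exact h00
    · exact hf1 _
  calc ∑ i, coordRisk r (biGridPrior r η) (θ i) (if θ i = 0 then 0 else f (θ i))
      ≤ ∑ i, (ENNReal.ofReal (2 * η) + if θ i ≠ 0 then ENNReal.ofReal T else 0) := by
        refine Finset.sum_le_sum fun i _ => ?_
        by_cases hi : θ i = 0
        · rw [if_pos hi, hi]
          simpa using h.coordRisk_zero_le hr
        · rw [if_neg hi, if_pos hi]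
          exact (hf2 _).trans le_add_self
    _ = ENNReal.ofReal (n * (2 * η) + (Finset.univ.filter fun i => θ i ≠ 0).card * T) := by
        rw [Finset.sum_add_distrib, ← Finset.sum_filter, Finset.sum_const, Finset.sum_const,
          Finset.card_univ, Fintype.card_fin, nsmul_eq_mul, nsmul_eq_mul,
          ENNReal.ofReal_add (mul_nonneg n.cast_nonneg (by linarith [h.pos])) (by positivity),
          ENNReal.ofReal_mul (p := (n : ℝ)) n.cast_nonneg,
          ENNReal.ofReal_mul (p := ((Finset.univ.filter fun i => θ i ≠ 0).card : ℝ))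
            (Nat.cast_nonneg _), ENNReal.ofReal_natCast, ENNReal.ofReal_natCast]
    _ ≤ _ := by
        refine ENNReal.ofReal_le_ofReal ?_
        -- The zero-coordinate cost, charged to all n coordinates, amounts to 2 per allowed spike.
        have e1 : (n : ℝ) * (2 * η) = 2 * s := by
          rw [hη]; field_simp
        have := mul_le_mul_of_nonneg_right hθ' hT0
        have e2 : (s : ℝ) * ((r : ℝ)⁻¹ * spacing r η ^ 2 / 2
            + (15 + 8 * (r : ℝ)⁻¹) / 2 * spacing r η + (Real.log 102 + 2)) = s * T + 2 * s := by
          rw [hT]; ring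
        rw [e1, e2]
        linarith

end BiGridRisk

/-! ### The lower bound: one spike in each of `s` blocks -/

theorem integrable_comp_gaussianLaw {n : ℕ} {σ2 : ℝ≥0} {θ : Fin n → ℝ} {i : Fin n} {t : ℝ}
    (ht : θ i = t) {f : ℝ → ℝ} (hf : Integrable f (gaussianReal t σ2)) :
    Integrable (fun z => f (z i)) (gaussianLaw σ2 θ) := by
  subst ht
  exact integrable_comp_eval (μ := fun i => gaussianReal (θ i) σ2) hf

theorem integral_comp_gaussianLaw {n : ℕ} {σ2 : ℝ≥0} {θ : Fin n → ℝ} {i : Fin n} {t : ℝ}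
    (ht : θ i = t) {f : ℝ → ℝ} (hf : Integrable f (gaussianReal t σ2)) :
    ∫ z, f (z i) ∂(gaussianLaw σ2 θ) = ∫ u, f u ∂(gaussianReal t σ2) := by
  subst ht
  exact integral_comp_eval (μ := fun i => gaussianReal (θ i) σ2) hf.aestronglyMeasurable

theorem integrable_abs_sub (t : ℝ) (σ2 : ℝ≥0) :
    Integrable (fun u => |u - t|) (gaussianReal t σ2) :=
  ((integrable_id_gaussianReal t σ2).sub (integrable_const t)).abs

theorem integral_abs_sub_le (t : ℝ) (σ2 : ℝ≥0) :
    ∫ u, |u - t| ∂(gaussianReal t σ2) ≤ (σ2 + 1) / 2 := by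
  have hsq : Integrable (fun u => (u - t) ^ 2) (gaussianReal t σ2) :=
    ((memLp_id_gaussianReal (μ := t) (v := σ2) 2).sub (memLp_const t)).integrable_sq
  have hi : Integrable (fun u => ((u - t) ^ 2 + 1) / 2) (gaussianReal t σ2) :=
    (hsq.add (integrable_const _)).div_const _
  calc ∫ u, |u - t| ∂(gaussianReal t σ2) ≤ ∫ u, ((u - t) ^ 2 + 1) / 2 ∂(gaussianReal t σ2) := by
        refine integral_mono (integrable_abs_sub t σ2) hi fun u => ?_
        have := sq_nonneg (|u - t| - 1)
        have h2 : |u - t| ^ 2 = (u - t) ^ 2 := sq_abs _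
        simp only
        linarith
    _ = _ := by
        rw [integral_div, integral_add hsq (integrable_const _), integral_sub_sq]
        simp

theorem integral_exp_mul_gaussianReal_zero (σ2 : ℝ≥0) (c : ℝ) :
    ∫ u, Real.exp (c * u) ∂(gaussianReal 0 σ2) = Real.exp (σ2 * c ^ 2 / 2) := by
  have := congrFun (mgf_fun_id_gaussianReal (μ := 0) (v := σ2)) c
  rw [mgf] at this
  rw [this]; simp

/-! ### Spike vectors and the test function of the variational bound. -/

section Spikes

variable {n s m : ℕ} (e : Fin s × Fin m → Fin n) (ω : Fin s → Fin m) (h : ℝ)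

/-- The vector with a spike of height `h` at position `ω B` of the block `B`. -/
def spikes (i : Fin n) : ℝ :=
  open Classical in if ∃ B, e (B, ω B) = i then h else 0

theorem spikes_apply_spike (B : Fin s) : spikes e ω h (e (B, ω B)) = h := if_pos ⟨B, rfl⟩

variable {e}

theorem spikes_apply_of_ne (he : Function.Injective e) {B : Fin s} {k : Fin m} (hk : k ≠ ω B) :
    spikes e ω h (e (B, k)) = 0 := by
  refine if_neg ?_
  rintro ⟨B', hB'⟩
  have := he hB'
  simp only [Prod.mk.injEq] at this
  obtain ⟨rfl, h2⟩ := this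
  exact hk h2.symm

theorem spikes_apply_of_notMem {i : Fin n} (hi : i ∉ Set.range fun B => e (B, ω B)) :
    spikes e ω h i = 0 := if_neg hi

theorem injective_spike_position (he : Function.Injective e) :
    Function.Injective fun B => e (B, ω B) := fun _ _ hB => (Prod.mk.inj (he hB)).1

variable (e) in
theorem spikes_mem_sparseBall : spikes e ω h ∈ sparseBall n s := by
  change hammingNorm _ ≤ s
  calc (Finset.univ.filter fun i => spikes e ω h i ≠ 0).card
      ≤ (Finset.univ.image fun B => e (B, ω B)).card := by
        refine Finset.card_le_card fun i hi => ?_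
        by_contra hc
        refine (Finset.mem_filter.1 hi).2 (spikes_apply_of_notMem ω h ?_)
        rintro ⟨B, rfl⟩
        exact hc (Finset.mem_image_of_mem _ (Finset.mem_univ B))
    _ ≤ (Finset.univ : Finset (Fin s)).card := Finset.card_image_le
    _ = s := by simp

theorem gaussianDensity_spikes (he : Function.Injective e) (x : Fin n → ℝ) :
    ENNReal.ofReal (Real.exp (∑ B, (h ^ 2 / 2 - h * x (e (B, ω B)))))
      * gaussianDensity 1 (spikes e ω h) x = gaussianDensity 1 0 x := by
  rw [gaussianDensity_eq_exp_mul (spikes e ω h) 0 x, ← mul_assoc,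
    ← ENNReal.ofReal_mul (Real.exp_pos _).le, ← Real.exp_add]
  have : ∑ B, (h * x (e (B, ω B)) - h ^ 2 / 2)
      = ∑ i, ((x i - (0 : Fin n → ℝ) i) ^ 2 - (x i - spikes e ω h i) ^ 2)
        / (2 * ((1 : ℝ≥0) : ℝ)) := by
    refine Fintype.sum_of_injective _ (injective_spike_position ω he) _ _ (fun i hi => ?_)
      fun B => ?_
    · rw [spikes_apply_of_notMem ω h hi]; simp
    · rw [spikes_apply_spike]; simp; ring
  rw [← this, ← Finset.sum_add_distrib]
  simp

/-- The contribution of the block `B` to the variational test function: a lower bound for the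
logarithm of the posterior odds of `spikes e ω h` given `(x, y)`, minus the log-likelihood ratio
of `x`. -/
def blockScore (e : Fin s × Fin m → Fin n) (ω : Fin s → Fin m) (h κ : ℝ) (x y : Fin n → ℝ)
    (B : Fin s) : ℝ :=
  (Real.log m - Real.log 2
      - (∑ k ∈ Finset.univ.erase (ω B),
        Real.exp (h * x (e (B, k))) * Real.exp (h * κ * y (e (B, k)))) / (m : ℝ) ^ 2
      - (h * |x (e (B, ω B)) - h| + h * κ * |y (e (B, ω B)) - h|))
    + (h ^ 2 / 2 - h * x (e (B, ω B)))

/-- The posterior probability of the position `k` in the block `B` under a uniform prior. -/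
def softmax (e : Fin s × Fin m → Fin n) (h κ : ℝ) (x y : Fin n → ℝ) (B : Fin s) (k : Fin m) : ℝ :=
  Real.exp (h * (x (e (B, k)) + κ * y (e (B, k))))
    / ∑ l, Real.exp (h * (x (e (B, l)) + κ * y (e (B, l))))

variable (e) in
theorem sum_softmax [NeZero m] (κ : ℝ) (x y : Fin n → ℝ) (B : Fin s) :
    ∑ k, softmax e h κ x y B k = 1 := by
  simp only [softmax]
  rw [← Finset.sum_div, div_self]
  exact (Finset.sum_pos (fun _ _ => Real.exp_pos _) Finset.univ_nonempty).ne'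

variable {h}

/-- The softmax at `ω B` is W/(W + S). At x = y = h on the spike, W = m² because (1+κ)h² = 2 log m;
in general W e^u ≥ m². Hence W + S ≤ (W + m²)(1 + S/m²) ≤ 2W e^u e^(S/m²). The score is linear in S
so that its mean is explicit. -/
theorem exp_blockScore_le (hm : 1 ≤ m) (hh : 0 ≤ h) {κ : ℝ} (hκ : 0 ≤ κ)
    (hhm : (1 + κ) * h ^ 2 / 2 = Real.log m) (x y : Fin n → ℝ) (B : Fin s) :
    Real.exp (blockScore e ω h κ x y B)
      ≤ m * softmax e h κ x y B (ω B) * Real.exp (h ^ 2 / 2 - h * x (e (B, ω B))) := by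
  have hm0 : (0 : ℝ) < m := by exact_mod_cast hm
  rw [blockScore, Real.exp_add]
  gcongr
  set S := ∑ k ∈ Finset.univ.erase (ω B),
    Real.exp (h * x (e (B, k))) * Real.exp (h * κ * y (e (B, k))) with hS
  set X := x (e (B, ω B))
  set Y := y (e (B, ω B))
  have hS0 : 0 ≤ S := Finset.sum_nonneg fun _ _ => by positivity
  have hsum : ∑ l, Real.exp (h * (x (e (B, l)) + κ * y (e (B, l))))
      = Real.exp (h * (X + κ * Y)) + S := by
    rw [← Finset.add_sum_erase _ _ (Finset.mem_univ (ω B)), hS]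
    congr 1
    refine Finset.sum_congr rfl fun k _ => ?_
    rw [← Real.exp_add]; congr 1; ring
  have hm2 : (m : ℝ) ^ 2 = Real.exp ((1 + κ) * h ^ 2) := by
    rw [show (1 + κ) * h ^ 2 = Real.log m + Real.log m by linarith, Real.exp_add,
      Real.exp_log hm0, sq]
  set W := Real.exp (h * (X + κ * Y)) with hW
  have hW0 : 0 < W := Real.exp_pos _
  set u := h * |X - h| + h * κ * |Y - h| with hu
  have hu0 : 0 ≤ u := by positivity
  have h1 : (m : ℝ) ^ 2 ≤ W * Real.exp u := by
    rw [hm2, hW, ← Real.exp_add, Real.exp_le_exp, hu]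
    have h2 := mul_le_mul_of_nonneg_left (neg_abs_le (X - h)) hh
    have h3 := mul_le_mul_of_nonneg_left (neg_abs_le (Y - h)) (mul_nonneg hh hκ)
    nlinarith
  have h4 : 1 + S / (m : ℝ) ^ 2 ≤ Real.exp (S / (m : ℝ) ^ 2) := by
    linarith [Real.add_one_le_exp (S / (m : ℝ) ^ 2)]
  have h5 : 1 ≤ Real.exp u := Real.one_le_exp hu0
  have h6 : W + S ≤ 2 * W * (Real.exp u * Real.exp (S / (m : ℝ) ^ 2)) := by
    calc W + S ≤ (W + (m : ℝ) ^ 2) * (1 + S / (m : ℝ) ^ 2) := by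
          have e1 : (W + (m : ℝ) ^ 2) * (1 + S / (m : ℝ) ^ 2)
              = W + S + ((m : ℝ) ^ 2 + W * (S / (m : ℝ) ^ 2)) := by field_simp; ring
          rw [e1]
          have : 0 ≤ (m : ℝ) ^ 2 + W * (S / (m : ℝ) ^ 2) := by positivity
          linarith
      _ ≤ (W * Real.exp u + W * Real.exp u) * Real.exp (S / (m : ℝ) ^ 2) := by
          gcongr
          exact le_mul_of_one_le_right hW0.le h5
      _ = _ := by ring
  rw [softmax, hsum, Real.exp_sub, Real.exp_sub, Real.exp_sub, Real.exp_log hm0,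
    Real.exp_log two_pos, ← mul_div_assoc, div_div, div_div, div_le_div_iff₀ (by positivity)
    (by positivity)]
  calc (m : ℝ) * (W + S) ≤ m * (2 * W * (Real.exp u * Real.exp (S / (m : ℝ) ^ 2))) := by gcongr
    _ = _ := by ring

/-- The sum of the block scores, as a function on `ℝⁿ × ℝⁿ`. -/
def score (e : Fin s × Fin m → Fin n) (ω : Fin s → Fin m) (h κ : ℝ) (x y : Fin n → ℝ) : ℝ :=
  ∑ B, blockScore e ω h κ x y B

theorem measurable_score (κ : ℝ) :
    Measurable fun q : (Fin n → ℝ) × (Fin n → ℝ) => score e ω h κ q.1 q.2 := by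
  unfold score blockScore
  fun_prop

theorem measurable_score_right (κ : ℝ) (x : Fin n → ℝ) : Measurable (score e ω h κ x) := by
  unfold score blockScore
  fun_prop

/-- The terms h²/2 - hx convert the density of x under the spikes into that under 0, which no longer
depends on ω; the other factor sums over ω to a constant. -/
theorem ofReal_exp_score_mul_le (he : Function.Injective e) (hm : 1 ≤ m) (hh : 0 ≤ h) {κ : ℝ}
    (hκ : 0 ≤ κ) (hhm : (1 + κ) * h ^ 2 / 2 = Real.log m) (x y : Fin n → ℝ) :
    ENNReal.ofReal (Real.exp (score e ω h κ x y)) * gaussianDensity 1 (spikes e ω h) x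
      ≤ ENNReal.ofReal (∏ B, (m * softmax e h κ x y B (ω B))) * gaussianDensity 1 0 x := by
  have hsm : ∀ B k, 0 ≤ softmax e h κ x y B k := fun B k =>
    div_nonneg (Real.exp_pos _).le (Finset.sum_nonneg fun _ _ => (Real.exp_pos _).le)
  have h1 : Real.exp (score e ω h κ x y) ≤ (∏ B, (m * softmax e h κ x y B (ω B)))
      * Real.exp (∑ B, (h ^ 2 / 2 - h * x (e (B, ω B)))) := by
    rw [score, Real.exp_sum, Real.exp_sum, ← Finset.prod_mul_distrib]
    exact Finset.prod_le_prod (fun _ _ => (Real.exp_pos _).le) fun B _ =>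
      exp_blockScore_le ω hm hh hκ hhm x y B
  rw [← gaussianDensity_spikes ω h he x, ← mul_assoc,
    ← ENNReal.ofReal_mul (Finset.prod_nonneg fun B _ => mul_nonneg m.cast_nonneg (hsm B _))]
  gcongr

variable (e) in
theorem sum_prod_softmax [NeZero m] (κ : ℝ) (x y : Fin n → ℝ) :
    ∑ ω : Fin s → Fin m, ENNReal.ofReal (∏ B, (m * softmax e h κ x y B (ω B)))
      = (m : ℝ≥0∞) ^ s := by
  have hsm : ∀ B k, 0 ≤ softmax e h κ x y B k := fun B k =>
    div_nonneg (Real.exp_pos _).le (Finset.sum_nonneg fun _ _ => (Real.exp_pos _).le)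
  rw [← ENNReal.ofReal_sum_of_nonneg fun ω _ =>
    Finset.prod_nonneg fun B _ => mul_nonneg m.cast_nonneg (hsm B _)]
  have := Finset.prod_univ_sum (fun _ : Fin s => (Finset.univ : Finset (Fin m)))
    fun B k => (m : ℝ) * softmax e h κ x y B k
  rw [Fintype.piFinset_univ] at this
  rw [← this]
  simp_rw [← Finset.mul_sum, sum_softmax]
  simp [ENNReal.ofReal_pow]

/-- On average over the m^s positions the exponential moment is at most 1, whatever the estimator.
After summing over ω the integrand is dominated by m^s p(y | x) times the density of N(0, I) at x,
which integrates to m^s. -/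
theorem sum_lintegral_exp_score_le [NeZero m] (he : Function.Injective e) (hm : 1 ≤ m)
    (hh : 0 ≤ h) {κ : ℝ} (hκ : 0 ≤ κ) (hhm : (1 + κ) * h ^ 2 / 2 = Real.log m)
    {p : (Fin n → ℝ) → (Fin n → ℝ) → ℝ≥0∞} (hp : IsPredictiveDensity p) :
    ∑ ω : Fin s → Fin m, ∫⁻ x, ∫⁻ y, ENNReal.ofReal (Real.exp (score e ω h κ x y))
        ∂(volume.withDensity (p x)) ∂(gaussianLaw 1 (spikes e ω h)) ≤ (m : ℝ≥0∞) ^ s := by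
  have hsc : ∀ ω : Fin s → Fin m, Measurable fun q : (Fin n → ℝ) × (Fin n → ℝ) =>
      ENNReal.ofReal (Real.exp (score e ω h κ q.1 q.2)) := fun ω =>
    (measurable_score ω κ).exp.ennreal_ofReal
  have hpm : Measurable fun q : (Fin n → ℝ) × (Fin n → ℝ) => p q.1 q.2 := hp.measurable
  have hsx : ∀ (ω : Fin s → Fin m) x, Measurable fun y =>
      ENNReal.ofReal (Real.exp (score e ω h κ x y)) := fun ω x =>
    (measurable_score_right ω κ x).exp.ennreal_ofReal
  have hpsx : ∀ (ω : Fin s → Fin m) x, Measurable fun y =>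
      p x y * ENNReal.ofReal (Real.exp (score e ω h κ x y)) := fun ω x =>
    (hp.measurable_apply x).mul (hsx ω x)
  have hjoint : ∀ ω : Fin s → Fin m, Measurable fun q : (Fin n → ℝ) × (Fin n → ℝ) =>
      p q.1 q.2 * ENNReal.ofReal (Real.exp (score e ω h κ q.1 q.2)) := fun ω => hpm.mul (hsc ω)
  have h1 : ∀ ω : Fin s → Fin m, ∫⁻ x, ∫⁻ y, ENNReal.ofReal (Real.exp (score e ω h κ x y))
        ∂(volume.withDensity (p x)) ∂(gaussianLaw 1 (spikes e ω h))
      = ∫⁻ x, ∫⁻ y, gaussianDensity 1 (spikes e ω h) x *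
        (p x y * ENNReal.ofReal (Real.exp (score e ω h κ x y))) := by
    intro ω
    have h2 : ∀ x, ∫⁻ y, ENNReal.ofReal (Real.exp (score e ω h κ x y)) ∂(volume.withDensity (p x))
        = ∫⁻ y, p x y * ENNReal.ofReal (Real.exp (score e ω h κ x y)) := fun x =>
      lintegral_withDensity_eq_lintegral_mul _ (hp.measurable_apply x) (hsx ω x)
    simp_rw [h2]
    have hin : Measurable fun x => ∫⁻ y, p x y * ENNReal.ofReal (Real.exp (score e ω h κ x y)) :=
      (hjoint ω).lintegral_prod_right'
    rw [gaussianLaw_eq_withDensity one_ne_zero,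
      lintegral_withDensity_eq_lintegral_mul _ (measurable_gaussianDensity_right 1 _) hin]
    refine lintegral_congr fun x => ?_
    rw [Pi.mul_apply, lintegral_const_mul _ (hpsx ω x)]
  simp_rw [h1]
  have hfull : ∀ ω : Fin s → Fin m, Measurable fun q : (Fin n → ℝ) × (Fin n → ℝ) =>
      gaussianDensity 1 (spikes e ω h) q.1 *
        (p q.1 q.2 * ENNReal.ofReal (Real.exp (score e ω h κ q.1 q.2))) := fun ω =>
    (measurable_gaussianDensity_comp 1 measurable_const measurable_fst).mul (hjoint ω)
  have hin : ∀ ω : Fin s → Fin m, Measurable fun x => ∫⁻ y, gaussianDensity 1 (spikes e ω h) x *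
      (p x y * ENNReal.ofReal (Real.exp (score e ω h κ x y))) := fun ω =>
    (hfull ω).lintegral_prod_right'
  rw [← lintegral_finsetSum _ fun ω _ => hin ω]
  have h3 : ∀ x, ∑ ω : Fin s → Fin m, ∫⁻ y, gaussianDensity 1 (spikes e ω h) x *
        (p x y * ENNReal.ofReal (Real.exp (score e ω h κ x y)))
      ≤ (m : ℝ≥0∞) ^ s * gaussianDensity 1 0 x := by
    intro x
    rw [← lintegral_finsetSum _ fun ω _ => (hpsx ω x).const_mul _]
    calc _ ≤ ∫⁻ y, ((m : ℝ≥0∞) ^ s * gaussianDensity 1 0 x) * p x y := by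
          refine lintegral_mono fun y => ?_
          rw [← sum_prod_softmax (h := h) e κ x y, Finset.sum_mul, Finset.sum_mul]
          refine Finset.sum_le_sum fun ω _ => ?_
          have := ofReal_exp_score_mul_le ω he hm hh hκ hhm x y
          calc _ = (ENNReal.ofReal (Real.exp (score e ω h κ x y))
                * gaussianDensity 1 (spikes e ω h) x) * p x y := by ring
            _ ≤ _ := by gcongr
      _ = _ := by
          rw [lintegral_const_mul _ (hp.measurable_apply x), hp.lintegral_eq_one, mul_one]
  refine (lintegral_mono h3).trans ?_
  rw [lintegral_const_mul _ (measurable_gaussianDensity_right 1 _),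
    lintegral_gaussianDensity one_ne_zero, mul_one]

/-- A lower bound for the mean of a block score. -/
def scoreBound (m : ℕ) (h κ r : ℝ) : ℝ :=
  Real.log m - Real.log 2 - 1 - h - h * κ * ((r + 1) / 2) - h ^ 2 / 2

variable (h) in
/-- The mean of the block score over the future observation. -/
def meanBlockScore (e : Fin s × Fin m → Fin n) (ω : Fin s → Fin m) (κ : ℝ) (r : ℝ≥0)
    (x : Fin n → ℝ) (B : Fin s) : ℝ :=
  (Real.log m - Real.log 2
      - (∑ k ∈ Finset.univ.erase (ω B),
        Real.exp (h * x (e (B, k))) * Real.exp (r * (h * κ) ^ 2 / 2)) / (m : ℝ) ^ 2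
      - (h * |x (e (B, ω B)) - h| + h * κ * ∫ u, |u - h| ∂(gaussianReal h r)))
    + (h ^ 2 / 2 - h * x (e (B, ω B)))

theorem integral_blockScore (he : Function.Injective e) (κ : ℝ) (r : ℝ≥0) (x : Fin n → ℝ)
    (B : Fin s) :
    Integrable (fun y => blockScore e ω h κ x y B) (gaussianLaw r (spikes e ω h)) ∧
      ∫ y, blockScore e ω h κ x y B ∂(gaussianLaw r (spikes e ω h))
        = meanBlockScore h e ω κ r x B := by
  have hk : ∀ k ∈ Finset.univ.erase (ω B), Integrable (fun y : Fin n → ℝ =>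
      Real.exp (h * x (e (B, k))) * Real.exp (h * κ * y (e (B, k))))
      (gaussianLaw r (spikes e ω h)) := fun k hk =>
    (integrable_comp_gaussianLaw (spikes_apply_of_ne ω h he (Finset.mem_erase.1 hk).1)
      (integrable_exp_mul_gaussianReal (h * κ))).const_mul _
  have h1 := (integrable_finsetSum _ hk).div_const ((m : ℝ) ^ 2)
  have h2 := (integrable_comp_gaussianLaw (spikes_apply_spike e ω h B)
    (integrable_abs_sub h r)).const_mul (h * κ)
  have h3 : Integrable (fun y : Fin n → ℝ => h * |x (e (B, ω B)) - h|
      + h * κ * |y (e (B, ω B)) - h|) (gaussianLaw r (spikes e ω h)) :=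
    (integrable_const _).add h2
  have h4 : Integrable (fun y : Fin n → ℝ => Real.log m - Real.log 2
      - (∑ k ∈ Finset.univ.erase (ω B),
        Real.exp (h * x (e (B, k))) * Real.exp (h * κ * y (e (B, k)))) / (m : ℝ) ^ 2)
      (gaussianLaw r (spikes e ω h)) := (integrable_const _).sub h1
  have h5 := h4.sub h3
  refine ⟨h5.add (integrable_const _), ?_⟩
  unfold blockScore meanBlockScore
  rw [integral_add (by exact h5) (integrable_const _), integral_sub h4 h3,
    integral_sub (integrable_const _) h1, integral_div, integral_finsetSum _ hk,
    integral_add (integrable_const _) h2, integral_const_mul (h * κ),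
    integral_comp_gaussianLaw (spikes_apply_spike e ω h B) (integrable_abs_sub h r)]
  have hmean : ∀ k ∈ Finset.univ.erase (ω B), ∫ y : Fin n → ℝ,
      Real.exp (h * x (e (B, k))) * Real.exp (h * κ * y (e (B, k)))
      ∂(gaussianLaw r (spikes e ω h))
      = Real.exp (h * x (e (B, k))) * Real.exp (r * (h * κ) ^ 2 / 2) := fun k hk' => by
    rw [integral_const_mul, integral_comp_gaussianLaw
      (spikes_apply_of_ne ω h he (Finset.mem_erase.1 hk').1)
      (integrable_exp_mul_gaussianReal (h * κ)), integral_exp_mul_gaussianReal_zero]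
  rw [Finset.sum_congr rfl hmean]
  simp

/-- Off the spike, the exponential moments in x and y multiply to exp((1+κ)h²/2) = m, so the
competing positions contribute at most 1 after division by m². On the spike, h²/2 - hx has mean
-h²/2, and the absolute deviations cost O(h). -/
theorem scoreBound_le_integral_meanBlockScore (he : Function.Injective e) (hm : 1 ≤ m)
    (hh : 0 ≤ h) {r : ℝ≥0} (hr : 0 < r)
    (hhm : (1 + (r : ℝ)⁻¹) * h ^ 2 / 2 = Real.log m) (B : Fin s) :
    Integrable (fun x => meanBlockScore h e ω (r : ℝ)⁻¹ r x B) (gaussianLaw 1 (spikes e ω h)) ∧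
      scoreBound m h (r : ℝ)⁻¹ r
        ≤ ∫ x, meanBlockScore h e ω (r : ℝ)⁻¹ r x B ∂(gaussianLaw 1 (spikes e ω h)) := by
  have hm0 : (0 : ℝ) < m := by exact_mod_cast hm
  have hr0 : (0 : ℝ) < r := hr
  set κ := (r : ℝ)⁻¹ with hκ
  have hκ0 : 0 < κ := inv_pos.2 hr0
  have hk : ∀ k ∈ Finset.univ.erase (ω B), Integrable (fun x : Fin n → ℝ =>
      Real.exp (h * x (e (B, k))) * Real.exp (r * (h * κ) ^ 2 / 2))
      (gaussianLaw 1 (spikes e ω h)) := fun k hk =>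
    (integrable_comp_gaussianLaw (spikes_apply_of_ne ω h he (Finset.mem_erase.1 hk).1)
      (integrable_exp_mul_gaussianReal h)).mul_const _
  have h1 := (integrable_finsetSum _ hk).div_const ((m : ℝ) ^ 2)
  have h2 := (integrable_comp_gaussianLaw (spikes_apply_spike e ω h B)
    (integrable_abs_sub h 1)).const_mul h
  have h3 : Integrable (fun x : Fin n → ℝ => h * |x (e (B, ω B)) - h|
      + h * κ * ∫ u, |u - h| ∂(gaussianReal h r)) (gaussianLaw 1 (spikes e ω h)) :=
    h2.add (integrable_const _)
  have h4 : Integrable (fun x : Fin n → ℝ => Real.log m - Real.log 2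
      - (∑ k ∈ Finset.univ.erase (ω B),
        Real.exp (h * x (e (B, k))) * Real.exp (r * (h * κ) ^ 2 / 2)) / (m : ℝ) ^ 2)
      (gaussianLaw 1 (spikes e ω h)) := (integrable_const _).sub h1
  have h5 := h4.sub h3
  have h6 := (integrable_comp_gaussianLaw (spikes_apply_spike e ω h B)
    (integrable_id_gaussianReal h 1)).const_mul h
  have h7 : Integrable (fun x : Fin n → ℝ => h ^ 2 / 2 - h * x (e (B, ω B)))
      (gaussianLaw 1 (spikes e ω h)) := (integrable_const _).sub h6
  refine ⟨h5.add h7, ?_⟩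
  unfold meanBlockScore
  rw [integral_add (by exact h5) h7, integral_sub h4 h3,
    integral_sub (integrable_const _) h1, integral_div, integral_finsetSum _ hk,
    integral_add h2 (integrable_const _), integral_const_mul h,
    integral_comp_gaussianLaw (spikes_apply_spike e ω h B) (integrable_abs_sub h 1),
    integral_sub (integrable_const _) h6, integral_const_mul h,
    integral_comp_gaussianLaw (spikes_apply_spike e ω h B) (integrable_id_gaussianReal h 1),
    integral_id_gaussianReal]
  have hmean : ∀ k ∈ Finset.univ.erase (ω B), ∫ x : Fin n → ℝ,
      Real.exp (h * x (e (B, k))) * Real.exp (r * (h * κ) ^ 2 / 2)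
      ∂(gaussianLaw 1 (spikes e ω h)) = m := fun k hk' => by
    rw [integral_mul_const, integral_comp_gaussianLaw
      (spikes_apply_of_ne ω h he (Finset.mem_erase.1 hk').1)
      (integrable_exp_mul_gaussianReal h), integral_exp_mul_gaussianReal_zero, ← Real.exp_add,
      ← Real.exp_log hm0, ← hhm]
    congr 1
    have : (r : ℝ) * κ = 1 := mul_inv_cancel₀ hr0.ne'
    simp only [NNReal.coe_one]
    rw [mul_pow]
    linear_combination (h ^ 2 * κ / 2) * this
  rw [Finset.sum_congr rfl hmean]
  have hcard : (∑ _k ∈ Finset.univ.erase (ω B), (m : ℝ)) / (m : ℝ) ^ 2 ≤ 1 := by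
    rw [div_le_one (by positivity), Finset.sum_const, nsmul_eq_mul, sq]
    gcongr
    calc (Finset.univ.erase (ω B)).card ≤ (Finset.univ : Finset (Fin m)).card :=
          Finset.card_le_card (Finset.erase_subset _ _)
      _ = m := by simp
  have ha1 := mul_le_mul_of_nonneg_left (integral_abs_sub_le h 1) hh
  have ha2 := mul_le_mul_of_nonneg_left (integral_abs_sub_le h r) (mul_nonneg hh hκ0.le)
  simp only [integral_const, probReal_univ, smul_eq_mul, one_mul, NNReal.coe_one] at *
  rw [scoreBound]
  nlinarith

/-- The variational inequality is applied for each x and then integrated. Its linearised form, free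
of the logarithm of the moment, is what allows averaging over x and later over ω. -/
theorem ofReal_le_klRisk_add (he : Function.Injective e) (hm : 1 ≤ m)
    (hh : 0 ≤ h) {r : ℝ≥0} (hr : 0 < r)
    (hhm : (1 + (r : ℝ)⁻¹) * h ^ 2 / 2 = Real.log m)
    {p : (Fin n → ℝ) → (Fin n → ℝ) → ℝ≥0∞} (hp : IsPredictiveDensity p) :
    ENNReal.ofReal (1 + s * scoreBound m h (r : ℝ)⁻¹ r)
      ≤ klRisk r (spikes e ω h) p
        + ∫⁻ x, ∫⁻ y, ENNReal.ofReal (Real.exp (score e ω h (r : ℝ)⁻¹ x y))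
          ∂(volume.withDensity (p x)) ∂(gaussianLaw 1 (spikes e ω h)) := by
  set κ := (r : ℝ)⁻¹ with hκ
  have hx : ∀ x, ENNReal.ofReal (1 + ∑ B, meanBlockScore h e ω κ r x B)
      ≤ klLoss r (spikes e ω h) (p x) + ∫⁻ y, ENNReal.ofReal (Real.exp (score e ω h κ x y))
          ∂(volume.withDensity (p x)) := by
    intro x
    have : IsProbabilityMeasure (volume.withDensity (p x)) := ⟨by simp [hp.lintegral_eq_one]⟩
    have hB := fun B => integral_blockScore ω he (h := h) κ r x B
    have hint : Integrable (score e ω h κ x) (gaussianLaw r (spikes e ω h)) :=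
      integrable_finsetSum _ fun B _ => (hB B).1
    have hval : ∫ y, score e ω h κ x y ∂(gaussianLaw r (spikes e ω h))
        = ∑ B, meanBlockScore h e ω κ r x B := by
      unfold score
      rw [integral_finsetSum _ fun B _ => (hB B).1]
      exact Finset.sum_congr rfl fun B _ => (hB B).2
    rw [← hval]
    exact ofReal_integral_le_klDiv_add (measurable_score_right ω κ x) hint
  have hB := fun B => scoreBound_le_integral_meanBlockScore ω he hm hh hr hhm B
  have hsum : Integrable (fun x => ∑ B, meanBlockScore h e ω κ r x B)
      (gaussianLaw 1 (spikes e ω h)) := integrable_finsetSum _ fun B _ => (hB B).1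
  have hsum1 : Integrable (fun x => 1 + ∑ B, meanBlockScore h e ω κ r x B)
      (gaussianLaw 1 (spikes e ω h)) := (integrable_const _).add hsum
  have hmeas : Measurable fun x => ∫⁻ y, ENNReal.ofReal (Real.exp (score e ω h κ x y))
          ∂(volume.withDensity (p x)) := by
    have hjoint : Measurable fun q : (Fin n → ℝ) × (Fin n → ℝ) =>
        p q.1 q.2 * ENNReal.ofReal (Real.exp (score e ω h κ q.1 q.2)) :=
      Measurable.mul (f := fun q => p q.1 q.2) hp.measurable
        (measurable_score ω κ).exp.ennreal_ofReal
    have hin : Measurable fun x => ∫⁻ y, p x y * ENNReal.ofReal (Real.exp (score e ω h κ x y)) :=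
      hjoint.lintegral_prod_right'
    have h2 : ∀ x, ∫⁻ y, ENNReal.ofReal (Real.exp (score e ω h κ x y)) ∂(volume.withDensity (p x))
        = ∫⁻ y, p x y * ENNReal.ofReal (Real.exp (score e ω h κ x y)) := fun x =>
      lintegral_withDensity_eq_lintegral_mul _ (hp.measurable_apply x)
        (measurable_score_right ω κ x).exp.ennreal_ofReal
    simp_rw [h2]
    exact hin
  rw [klRisk, ← lintegral_add_right _ hmeas]
  refine le_trans ?_ (lintegral_mono hx)
  refine le_trans (ENNReal.ofReal_le_ofReal ?_) (ofReal_integral_le_lintegral_ofReal hsum1)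
  rw [integral_add (integrable_const _) hsum, integral_finsetSum _ fun B _ => (hB B).1]
  have := Finset.card_nsmul_le_sum Finset.univ
    (fun B => ∫ x, meanBlockScore h e ω κ r x B ∂(gaussianLaw 1 (spikes e ω h))) _
    fun B _ => (hB B).2
  simp only [Finset.card_univ, Fintype.card_fin, nsmul_eq_mul] at this
  simpa using this

end Spikes

theorem ofReal_le_minimaxRisk {r : ℝ≥0} (hr : 0 < r) {n s m : ℕ} (hm : 1 ≤ m) (hsm : s * m ≤ n)
    {h : ℝ} (hh : 0 ≤ h) (hhm : (1 + (r : ℝ)⁻¹) * h ^ 2 / 2 = Real.log m) :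
    ENNReal.ofReal (s * scoreBound m h (r : ℝ)⁻¹ r) ≤ minimaxRisk r (sparseBall n s) := by
  set L := s * scoreBound m h (r : ℝ)⁻¹ r with hL
  rcases le_or_gt L 0 with hL0 | hL0
  · rw [ENNReal.ofReal_of_nonpos hL0]; exact zero_le
  have : NeZero m := ⟨by omega⟩
  -- The s blocks of length m occupy the first sm coordinates; the others stay zero.
  set e : Fin s × Fin m → Fin n := fun q => Fin.castLE hsm (finProdFinEquiv q)
  have he : Function.Injective e := (Fin.castLE_injective hsm).comp finProdFinEquiv.injective
  refine le_iInf₂ fun p hp => ?_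
  have hr0 : (0 : ℝ) ≤ (r : ℝ)⁻¹ := inv_nonneg.2 r.2
  have h1 : (m : ℝ≥0∞) ^ s * ENNReal.ofReal (1 + L)
      ≤ (m : ℝ≥0∞) ^ s * (maxRisk r (sparseBall n s) p + 1) := by
    calc (m : ℝ≥0∞) ^ s * ENNReal.ofReal (1 + L)
        = ∑ _ω : Fin s → Fin m, ENNReal.ofReal (1 + L) := by simp
      _ ≤ ∑ ω : Fin s → Fin m, (maxRisk r (sparseBall n s) p
          + ∫⁻ x, ∫⁻ y, ENNReal.ofReal (Real.exp (score e ω h (r : ℝ)⁻¹ x y))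
          ∂(volume.withDensity (p x)) ∂(gaussianLaw 1 (spikes e ω h))) := by
          refine Finset.sum_le_sum fun ω _ => ?_
          refine (ofReal_le_klRisk_add ω he hm hh hr hhm hp).trans ?_
          gcongr
          exact le_iSup₂ (f := fun θ (_ : θ ∈ sparseBall n s) => klRisk r θ p) _
            (spikes_mem_sparseBall e ω h)
      _ ≤ _ := by
          rw [Finset.sum_add_distrib, mul_add, mul_one]
          refine add_le_add (by simp) ?_
          exact sum_lintegral_exp_score_le he hm hh hr0 hhm hp
  have hm0 : (m : ℝ≥0∞) ^ s ≠ 0 := pow_ne_zero _ (by exact_mod_cast this.ne)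
  have hmt : (m : ℝ≥0∞) ^ s ≠ ∞ := ENNReal.pow_ne_top (ENNReal.natCast_ne_top m)
  have h2 := (ENNReal.mul_le_mul_iff_right hm0 hmt).1 h1
  -- The averaged inequality reads 1 + L ≤ maximal risk + 1, and the exponential moment cancels the
  -- 1.
  rw [add_comm, ENNReal.ofReal_add hL0.le zero_le_one, ENNReal.ofReal_one] at h2
  exact (ENNReal.add_le_add_iff_right ENNReal.one_ne_top).1 h2

/-! ### Asymptotics -/

theorem minimaxRisk_le_maxRisk_biGrid {r : ℝ≥0} (hr : 0 < r) (n s : ℕ) {η : ℝ}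
    (h0 : 0 < η) (h1 : η < 1) :
    minimaxRisk r (sparseBall n s)
      ≤ maxRisk r (sparseBall n s) (bayesDensity r (biGridPriorPi n r η)) := by
  have hpr := isProbabilityMeasure_biGridPos (r := r) hr h0 h1
  have hpr' : IsProbabilityMeasure (biGridPrior r η) :=
    isProbabilityMeasure_sparsePrior h0.le h1.le
  have : IsProbabilityMeasure (biGridPriorPi n r η) := by unfold biGridPriorPi; infer_instance
  exact iInf₂_le _ (isPredictiveDensity_bayesDensity _ hr.ne')

/-- With h² = 2v log m the leading term is log m - h²/2 = (1-v) log m. Rounding n/s down to m loses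
at most log 2 in the logarithm, and (1-v) log(1/η) = κλ²/2 because v(1+κ) = 1. -/
theorem exists_minimaxRisk_ge {r : ℝ≥0} (hr : 0 < r) :
    ∃ C D : ℝ, ∀ n s : ℕ, 1 ≤ s → s ≤ n →
      ENNReal.ofReal (s * ((r : ℝ)⁻¹ * spacing r ((s : ℝ) / n) ^ 2 / 2
        - C * spacing r ((s : ℝ) / n) - D)) ≤ minimaxRisk r (sparseBall n s) := by
  have hr0 : (0 : ℝ) < r := hr
  set κ := (r : ℝ)⁻¹ with hκ
  have hκ0 : 0 < κ := inv_pos.2 hr0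
  set v := oracleVar r with hv
  have hv0 : 0 < v := oracleVar_pos hr0
  have hv1 : v * (1 + κ) = 1 := inv_mul_cancel₀ (by positivity)
  have hv2 : 0 < 1 - v := by nlinarith
  refine ⟨1 + κ * ((r + 1) / 2), (1 - v) * Real.log 2 + Real.log 2 + 1, fun n s hs hsn => ?_⟩
  have hs0 : (0 : ℝ) < s := by exact_mod_cast hs
  have hsn' : (s : ℝ) ≤ n := by exact_mod_cast hsn
  have hn0 : (0 : ℝ) < n := hs0.trans_le hsn'
  set η := (s : ℝ) / n with hη
  have hη0 : 0 < η := by positivity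
  have hη1 : η ≤ 1 := (div_le_one hn0).2 hsn'
  have hlam : 0 ≤ spacing r η := Real.sqrt_nonneg _
  set m := n / s with hm
  have hm1 : 1 ≤ m := (Nat.one_le_div_iff hs).2 hsn
  have hsm : s * m ≤ n := Nat.mul_div_le n s
  have hm1' : (1 : ℝ) ≤ m := by exact_mod_cast hm1
  have hlogη : Real.log (n / s) = -Real.log η := by rw [hη, ← Real.log_inv, inv_div]
  have hlogm_le : Real.log m ≤ -Real.log η := by
    rw [← hlogη]
    exact Real.log_le_log (by linarith) Nat.cast_div_le
  have hlogm_ge : -Real.log η - Real.log 2 ≤ Real.log m := by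
    rw [← hlogη, ← Real.log_div (by positivity) two_ne_zero]
    refine Real.log_le_log (by positivity) ?_
    have h1 : n < s * (m + 1) := Nat.lt_mul_div_succ n hs
    have h2 : (n : ℝ) < s * (m + 1) := by exact_mod_cast h1
    rw [div_div, div_le_iff₀ (by positivity)]
    nlinarith
  have hlogm0 : 0 ≤ Real.log m := Real.log_nonneg hm1'
  set h := Real.sqrt (2 * (v * Real.log m)) with hh
  have hh0 : 0 ≤ h := Real.sqrt_nonneg _
  have hh2 : h ^ 2 = 2 * (v * Real.log m) := Real.sq_sqrt (by positivity)
  have hhm : (1 + κ) * h ^ 2 / 2 = Real.log m := by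
    rw [hh2]; linear_combination Real.log m * hv1
  have hlam2 := log_eq_neg_spacing_sq hr0 hη0 hη1
  rw [← hv] at hlam2
  have hhlam : h ≤ spacing r η := by
    rw [← Real.sqrt_sq hlam]
    refine Real.sqrt_le_sqrt ?_
    have := mul_le_mul_of_nonneg_left hlogm_le hv0.le
    linarith
  refine le_trans (ENNReal.ofReal_le_ofReal ?_) (ofReal_le_minimaxRisk hr hm1 hsm hh0 hhm)
  refine mul_le_mul_of_nonneg_left ?_ hs0.le
  rw [scoreBound, ← hκ, hh2]
  have h3 : κ * spacing r η ^ 2 / 2 = (1 - v) * (-Real.log η) := by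
    linear_combination κ * hlam2 + (-Real.log η) * hv1
  have h4 := mul_le_mul_of_nonneg_left hlogm_ge hv2.le
  have h5 : (1 + κ * ((r + 1) / 2)) * h ≤ (1 + κ * ((r + 1) / 2)) * spacing r η := by gcongr
  rw [h3]
  linarith

theorem tendsto_spacing {r : ℝ} (hr : 0 < r) {η : ℕ → ℝ} (hη : Tendsto η atTop (𝓝 0))
    (hpos : ∀ᶠ n in atTop, 0 < η n) : Tendsto (fun n => spacing r (η n)) atTop atTop := by
  have h1 : Tendsto η atTop (𝓝[>] 0) :=
    tendsto_nhdsWithin_iff.2 ⟨hη, hpos⟩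
  have h2 := (Real.tendsto_log_nhdsGT_zero.comp h1).const_mul_atBot (oracleVar_pos hr)
  have h3 : Tendsto (fun n => √(-2 * (oracleVar r * Real.log (η n)))) atTop atTop :=
    Real.tendsto_sqrt_atTop.comp (h2.const_mul_atBot_of_neg (by norm_num))
  refine h3.congr' ?_
  filter_upwards [hpos] with n hn
  rw [spacing, Real.log_rpow hn]
  congr 1; ring

theorem tendsto_quadratic_ratio {a : ℝ} (ha : 0 < a) (b c b' c' : ℝ) :
    Tendsto (fun x : ℝ => (a * x ^ 2 / 2 + b * x + c) / (a * x ^ 2 / 2 - b' * x - c'))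
      atTop (𝓝 1) := by
  have hi : Tendsto (fun x : ℝ => x⁻¹) atTop (𝓝 0) := tendsto_inv_atTop_zero
  have h1 : Tendsto (fun x : ℝ => (a / 2 + b * x⁻¹ + c * x⁻¹ ^ 2)
      / (a / 2 - b' * x⁻¹ - c' * x⁻¹ ^ 2)) atTop
      (𝓝 ((a / 2 + b * 0 + c * 0 ^ 2) / (a / 2 - b' * 0 - c' * 0 ^ 2))) :=
    ((tendsto_const_nhds.add (hi.const_mul b)).add ((hi.pow 2).const_mul c)).div
      ((tendsto_const_nhds.sub (hi.const_mul b')).sub ((hi.pow 2).const_mul c'))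
      (by simp [ha.ne'])
  have e : (a / 2 + b * 0 + c * 0 ^ 2) / (a / 2 - b' * 0 - c' * 0 ^ 2) = 1 := by
    simp [ha.ne']
  rw [e] at h1
  refine h1.congr' ?_
  filter_upwards [eventually_gt_atTop 0] with x hx
  rw [← mul_div_mul_left _ _ (pow_ne_zero 2 hx.ne')]
  congr 1 <;> field_simp

theorem tendsto_quadratic_atTop {a : ℝ} (ha : 0 < a) (b c : ℝ) :
    ∀ᶠ x : ℝ in atTop, 0 < a * x ^ 2 / 2 - b * x - c := by
  filter_upwards [eventually_ge_atTop 1, eventually_gt_atTop (2 * (|b| + |c|) / a)] with x h1 h2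
  rw [div_lt_iff₀ ha] at h2
  have h3 := le_abs_self b
  have h4 := le_abs_self c
  have h5 : 2 * (|b| + |c|) * x < x * a * x := by gcongr
  nlinarith [abs_nonneg b, abs_nonneg c]

end SparsePrediction

end

/-- The Bayes predictive density of the bi-grid prior is asymptotically minimax over sparse
`ℓ₀`-balls, for every variance ratio `r > 0`. The quotient is taken in `[0, ∞]`, where
`a / 0`, `a / ∞` and `∞ / a` are `0` or `∞`; so convergence to `1` entails that both risks
are eventually positive and finite. -/
theorem theorem2 (r : ℝ≥0) (hr : 0 < r) (s : ℕ → ℕ) (hs : ∀ᶠ n in atTop, 1 ≤ s n)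
    (hη : Tendsto (fun n : ℕ => (s n : ℝ) / n) atTop (𝓝 0)) :
    Tendsto
      (fun n : ℕ =>
        SparsePrediction.maxRisk r (SparsePrediction.sparseBall n (s n))
            (SparsePrediction.bayesDensity r
              (SparsePrediction.biGridPriorPi n r ((s n : ℝ) / n)))
          / SparsePrediction.minimaxRisk r (SparsePrediction.sparseBall n (s n)))
      atTop (𝓝 1) := by
  open SparsePrediction in
  have hr0 : (0 : ℝ) < r := hr
  have hpos : ∀ᶠ n : ℕ in atTop, 0 < (s n : ℝ) / n := by
    filter_upwards [hs, eventually_gt_atTop 0] with n h1 h2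
    have : (0 : ℝ) < s n := by exact_mod_cast h1
    positivity
  have hlam := tendsto_spacing hr0 hη hpos
  have hlarge : ∀ᶠ n : ℕ in atTop, IsLargeSpacing r ((s n : ℝ) / n) := by
    have hb := innerFactor_pos hr0
    filter_upwards [hpos, hη.eventually_lt_const one_pos, hlam.eventually_ge_atTop 4,
      hlam.eventually_ge_atTop (2 / innerFactor r ^ 2)] with n h1 h2 h3 h4
    exact ⟨h1, h2, h3, (div_le_iff₀ (by positivity)).1 h4⟩
  obtain ⟨C, D, hlower⟩ := exists_minimaxRisk_ge hr
  have hratio := (tendsto_quadratic_ratio (inv_pos.2 hr0) ((15 + 8 * (r : ℝ)⁻¹) / 2)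
    (Real.log 102 + 2) C D).comp hlam
  have hratio' := (ENNReal.tendsto_ofReal hratio)
  rw [ENNReal.ofReal_one] at hratio'
  have key : ∀ᶠ n : ℕ in atTop,
      1 ≤ maxRisk r (sparseBall n (s n)) (bayesDensity r (biGridPriorPi n r ((s n : ℝ) / n)))
          / minimaxRisk r (sparseBall n (s n)) ∧
      maxRisk r (sparseBall n (s n)) (bayesDensity r (biGridPriorPi n r ((s n : ℝ) / n)))
          / minimaxRisk r (sparseBall n (s n))
        ≤ ENNReal.ofReal (((fun x : ℝ => ((r : ℝ)⁻¹ * x ^ 2 / 2 + (15 + 8 * (r : ℝ)⁻¹) / 2 * x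
          + (Real.log 102 + 2)) / ((r : ℝ)⁻¹ * x ^ 2 / 2 - C * x - D)) ∘
            fun n : ℕ => spacing r ((s n : ℝ) / n)) n) := by
    filter_upwards [hlarge, hs, eventually_gt_atTop 0,
      hlam.eventually (tendsto_quadratic_atTop (inv_pos.2 hr0) C D)] with n h1 h2 h3 h4
    have hs0 : (0 : ℝ) < s n := by exact_mod_cast h2
    have hsn : s n ≤ n := by
      have h5 := h1.lt_one
      rw [div_lt_one (by exact_mod_cast h3)] at h5
      exact_mod_cast h5.le
    have hup := maxRisk_bayesDensity_biGrid_le hr h3 h1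
    have hlo := hlower n (s n) h2 hsn
    have hle := minimaxRisk_le_maxRisk_biGrid hr n (s n) h1.pos h1.lt_one
    -- Positivity and finiteness of the minimax risk are settled first, so that the quotient in [0,
    -- ∞] is a genuine one.
    have hmin0 : minimaxRisk r (sparseBall n (s n)) ≠ 0 :=
      (lt_of_lt_of_le (ENNReal.ofReal_pos.2 (mul_pos hs0 h4)) hlo).ne'
    have hmint : minimaxRisk r (sparseBall n (s n)) ≠ ∞ :=
      ne_top_of_le_ne_top ENNReal.ofReal_ne_top (hle.trans hup)
    constructor
    · rw [ENNReal.le_div_iff_mul_le (Or.inl hmin0) (Or.inl hmint), one_mul]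
      exact hle
    · refine (ENNReal.div_le_div hup hlo).trans ?_
      -- The factor s cancels, leaving a ratio of quadratics in λ with the same leading coefficient.
      rw [← ENNReal.ofReal_div_of_pos (mul_pos hs0 h4), mul_div_mul_left _ _ hs0.ne']
      exact le_rfl
  exact tendsto_of_tendsto_of_tendsto_of_le_of_le' tendsto_const_nhds hratio'
    (key.mono fun n hn => hn.1) (key.mono fun n hn => hn.2)
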